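/- **Riemann Bilinear Identity.** Let $S$ be a closed connected oriented surface of genus $g\ge 1$ with a triangulation $T$ (finitely many oriented triangles glued along pairs of sides, compatibly with the orientations; two distinct sides or corners of a triangle may represent the same edge or vertex). Let $T^1$ be the set of edges of $T$. Let $p\colon\widetilde S\to S$ be the universal covering, $\widetilde T$ the induced triangulation of $\widetilde S$, and $\widetilde T^0,\widetilde T^2$ the sets of vertices and faces of $\widetilde T$. Fix $z_0\in\widetilde S$ and closed paths $\alpha_1,\dots,\alpha_g,\beta_1,\dots,\beta_g$ in $S$ based at $p(z_0)$ that form a standard basis of $\pi_1(S,p(z_0))$, i.e. they generate this group and $\alpha_1\beta_1\alpha_1^{-1}\beta_1^{-1}\cdots\alpha_g\beta_g\alpha_g^{-1}\beta_g^{-1}$ is null-homotopic. Assume that the basis is positively oriented, i.e. the algebraic intersection number $\alpha_k\cdot\beta_k$ is positive for some (equivalently, for each) $k$; here a crossing is counted with sign $+1$ if $\beta_k$ crosses $\alpha_k$ from the right to the left. For a closed path $\alpha$ based at $p(z_0)$ denote by $d_\alpha\colon\widetilde S\to\widetilde S$ the deck transformation taking $z_0$ to the endpoint of the lift of $\alpha$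 starting at $z_0$. Let $u\colon\widetilde T^0\to\mathbb R$ and $u'\colon\widetilde T^2\to\mathbb R$ be multi-valued functions with real periods $A_1,\dots,A_g,B_1,\dots,B_g$ and $A'_1,\dots,A'_g,B'_1,\dots,B'_g$ respectively, i.e. for each $k$, each $z\in\widetilde T^0$ and each $w\in\widetilde T^2$ $$u(d_{\alpha_k}z)-u(z)=A_k,\quad u(d_{\beta_k}z)-u(z)=B_k,\quad u'(d_{\alpha_k}w)-u'(w)=A'_k,\quad u'(d_{\beta_k}w)-u'(w)=B'_k.$$ Fix an arbitrary orientation of each edge $e\in T^1$ and an arbitrary lift of the oriented edge to $\widetilde T$, and denote by $h_e,t_e,l_e,r_e$ the head, the tail, the left shore (the face of $\widetilde T$ to the left) and the right shore of the lift. Then $$\sum_{e\in T^1}\bigl(u'(l_e)-u'(r_e)\bigr)\bigl(u(h_e)-u(t_e)\bigr)=\sum_{k=1}^g\bigl(A_kB'_k-B_kA'_k\bigr).$$ -/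

import Mathlib

open scoped unitInterval

noncomputable section

namespace BilinearIdentity

/-! ### Triangles and oriented triangulated surfaces -/

/-- The closed triangle with corners `0, 1, 2`, oriented by the cyclic order `0 → 1 → 2 → 0`. -/
abbrev Triangle : Type := stdSimplex ℝ (Fin 3)

/-- The `i`-th corner of the triangle. -/
def corner (i : Fin 3) : Triangle := ⟨Pi.single i 1, single_mem_stdSimplex ℝ i⟩

/-- The `i`-th side of the triangle, parametrized by `[0,1]` from corner `i` to corner `i + 1`. -/
def side (i : Fin 3) (t : I) : Triangle :=
  ⟨fun j => if j = i then 1 - (t : ℝ) else if j = i + 1 then (t : ℝ) else 0, by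
    have h0 := t.2.1
    have h1 := t.2.2
    refine ⟨fun j => ?_, ?_⟩
    · dsimp only
      split_ifs <;> linarith
    · fin_cases i <;> simp [Fin.sum_univ_three]⟩

theorem side_zero (i : Fin 3) : side i 0 = corner i := by
  apply Subtype.ext
  funext j
  fin_cases i <;> fin_cases j <;> simp [side, corner]

theorem side_one (i : Fin 3) : side i 1 = corner (i + 1) := by
  apply Subtype.ext
  funext j
  fin_cases i <;> fin_cases j <;> simp [side, corner]

/-- Finitely many oriented triangles and a pairing `opp` of all their sides. The pair `(w, i)` is
the `i`-th side of the triangle `w`. -/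
structure Gluing where
  Face : Type
  [fintypeFace : Fintype Face]
  opp : Face × Fin 3 → Face × Fin 3
  opp_opp : ∀ d, opp (opp d) = d
  opp_ne : ∀ d, opp d ≠ d

attribute [instance] Gluing.fintypeFace

/-- Each point of a side is identified with a point of the paired side. The direction of the sides
is reversed, so that the orientations of the triangles agree. -/
inductive Gluing.Rel (G : Gluing) : (Σ _ : G.Face, Triangle) → (Σ _ : G.Face, Triangle) → Prop
  | glue (d : G.Face × Fin 3) (t : I) :
      Gluing.Rel G ⟨d.1, side d.2 t⟩ ⟨(G.opp d).1, side (G.opp d).2 (unitInterval.symm t)⟩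

/-- The closed oriented surface obtained from the disjoint union of the triangles by gluing their
sides, with the quotient topology. -/
def Gluing.Surface (G : Gluing) : Type := Quot G.Rel

instance (G : Gluing) : TopologicalSpace G.Surface :=
  inferInstanceAs (TopologicalSpace (Quot G.Rel))

/-- An oriented triangulation of a closed surface `S`: a homeomorphism of `S` with a surface glued
from oriented triangles. It determines the orientation of `S`. Two distinct sides or corners of a
triangle may represent the same edge or vertex of `S`. -/
structure Triangulation (S : Type*) [TopologicalSpace S] extends Gluing where
  homeo : toGluing.Surface ≃ₜ S

namespace Triangulation

variable {S : Type*} [TopologicalSpace S] (T : Triangulation S)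

/-- The characteristic map of the face `w`. -/
def cell (w : T.Face) (x : Triangle) : S :=
  T.homeo (Quot.mk T.toGluing.Rel ⟨w, x⟩)

/-- The set of vertices of the triangulation. -/
def vertices : Set S := {x | ∃ w i, x = T.cell w (corner i)}

/-- An oriented edge is represented by the side `(w, i)` of the face `w` to the left of it, and is
directed from corner `i` to corner `i + 1` of `w`. The same edge with the opposite orientation
is `T.opp (w, i)`. -/
abbrev OrientedEdge : Type := T.Face × Fin 3

/-- The (unoriented) edges of the triangulation. -/
def Edge : Type := Quot fun d d' : T.OrientedEdge => d' = T.opp d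

/-- The edge underlying an oriented edge. -/
def OrientedEdge.edge {T : Triangulation S} (d : T.OrientedEdge) : T.Edge := Quot.mk _ d

instance : Finite T.Edge := inferInstanceAs (Finite (Quot _))

instance : Fintype T.Edge := Fintype.ofFinite _

/-- The surface has genus `g`: its Euler characteristic is `2 - 2g`. -/
def HasGenus (g : ℕ) : Prop :=
  (T.vertices.ncard : ℤ) - Nat.card T.Edge + Nat.card T.Face = 2 - 2 * (g : ℤ)

/-! ### The induced triangulation of a covering -/

variable {E : Type*} [TopologicalSpace E] (p : E → S)

/-- Vertices of the covering triangulation. -/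
def LiftedVertex : Type _ := {z : E // p z ∈ T.vertices}

/-- Faces of the covering triangulation: lifts of the characteristic maps of the faces. -/
@[ext]
structure LiftedFace where
  face : T.Face
  map : C(Triangle, E)
  lift : ∀ x, p (map x) = T.cell face x

/-- Oriented edges of the covering triangulation, recorded together with the left shore, the right
shore, and the oriented edge of `T` below. The two shores share the corresponding side. -/
structure LiftedEdge where
  proj : T.OrientedEdge
  left : T.LiftedFace p
  right : T.LiftedFace p
  left_face : left.face = proj.1
  right_face : right.face = (T.opp proj).1
  adjacent : ∀ t : I,
    left.map (side proj.2 t) = right.map (side (T.opp proj).2 (unitInterval.symm t))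

variable {T p}

/-- The corners of a face of the covering triangulation. -/
def LiftedFace.vertex (w : T.LiftedFace p) (i : Fin 3) : T.LiftedVertex p :=
  ⟨w.map (corner i), w.face, i, w.lift _⟩

/-- The tail of an oriented edge. -/
def LiftedEdge.tail (e : T.LiftedEdge p) : T.LiftedVertex p := e.left.vertex e.proj.2

/-- The head of an oriented edge. -/
def LiftedEdge.head (e : T.LiftedEdge p) : T.LiftedVertex p := e.left.vertex (e.proj.2 + 1)

end Triangulation

/-! ### Deck transformations -/

/-- Homeomorphisms of the covering space commuting with the projection. -/
structure Deck {S E : Type*} [TopologicalSpace E] (p : E → S) where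
  toHomeo : E ≃ₜ E
  proj : ∀ z, p (toHomeo z) = p z

namespace Deck

variable {S E : Type*} [TopologicalSpace S] [TopologicalSpace E] {p : E → S}

/-- `d` is the deck transformation determined by the closed path `γ`: it takes the base point `z₀`
to the endpoint of the lift of `γ` starting at `z₀`. -/
def IsOf (d : Deck p) {z₀ : E} (γ : Path (p z₀) (p z₀)) : Prop :=
  ∃ Γ : Path z₀ (d.toHomeo z₀), ∀ t, p (Γ t) = γ t

/-- The action on vertices. -/
def onVertex (d : Deck p) {T : Triangulation S} (z : T.LiftedVertex p) : T.LiftedVertex p :=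
  ⟨d.toHomeo z.1, by rw [d.proj]; exact z.2⟩

/-- The action on faces. -/
def onFace (d : Deck p) {T : Triangulation S} (w : T.LiftedFace p) : T.LiftedFace p :=
  ⟨w.face, ⟨fun x => d.toHomeo (w.map x), d.toHomeo.continuous.comp w.map.continuous⟩,
    fun x => (d.proj _).trans (w.lift x)⟩

end Deck

/-! ### Standard bases of the fundamental group -/

section Basis

variable {S : Type*} [TopologicalSpace S] {x : S} {g : ℕ}

/-- The closed path `α β α⁻¹ β⁻¹`. -/
def commutatorLoop (a b : Path x x) : Path x x :=
  ((a.trans b).trans a.symm).trans b.symm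

/-- The closed path `α₁ β₁ α₁⁻¹ β₁⁻¹ … α_g β_g α_g⁻¹ β_g⁻¹`. -/
def relatorLoop (α β : Fin g → Path x x) : Path x x :=
  (List.ofFn fun k => commutatorLoop (α k) (β k)).foldr Path.trans (Path.refl x)

/-- The class of a closed path in the fundamental group. -/
def loopClass (γ : Path x x) : FundamentalGroup S x :=
  FundamentalGroup.fromPath (Path.Homotopic.Quotient.mk γ)

/-- On a closed surface of genus `g`: the `2g` closed paths form a standard basis of the
fundamental group (no orientation convention is imposed here). -/
structure IsStandardBasis (α β : Fin g → Path x x) : Prop where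
  generate : Subgroup.closure
    (Set.range (fun k => loopClass (α k)) ∪ Set.range (fun k => loopClass (β k))) = ⊤
  relator : (relatorLoop α β).Homotopic (Path.refl x)

end Basis

/-! ### Intersection numbers -/

section Intersection

variable {S : Type*} [TopologicalSpace S] {T : Triangulation S}
  {E : Type*} [TopologicalSpace E] {p : E → S}

/-- A list of oriented edges forms a path along edges from one vertex to another. -/
def IsEdgePath : T.LiftedVertex p → List (T.LiftedEdge p) → T.LiftedVertex p → Prop
  | z, [], z' => z = z'
  | z, e :: l, z' => e.tail = z ∧ IsEdgePath e.head l z'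

/-- A list of oriented edges which are crossed one after another, each from the right to the left,
by a path from one face to another. -/
def IsFacePath : T.LiftedFace p → List (T.LiftedEdge p) → T.LiftedFace p → Prop
  | w, [], w' => w = w'
  | w, e :: l, w' => e.right = w ∧ IsFacePath e.left l w'

open Classical in
/-- Contribution to the intersection number on the surface of passing along `e` and of crossing `f`
from the right to the left: `1` if they are over the same oriented edge of `T`, `-1` if over
opposite oriented edges, and `0` otherwise. -/
def crossing (e f : T.LiftedEdge p) : ℤ :=
  if f.proj = e.proj then 1 else if f.proj = T.opp e.proj then -1 else 0

variable (T) in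
/-- `n` is the algebraic intersection number `a · b` of the free homotopy classes of closed paths on
the surface corresponding to the deck transformations `d` and `d'` of the universal covering.
Their representatives are a closed path along edges of `T` and a closed path through adjacent
faces of `T`, the projections of paths from `z` to `d z` and from `w` to `d' w` respectively. A
crossing of the former by the latter from the right to the left is counted with sign `+1`. -/
def IsIntersectionNumber (d d' : Deck p) (n : ℤ) : Prop :=
  ∃ (z : T.LiftedVertex p) (a : List (T.LiftedEdge p))
    (w : T.LiftedFace p) (b : List (T.LiftedEdge p)),
    IsEdgePath z a (d.onVertex z) ∧ IsFacePath w b (d'.onFace w) ∧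
      n = (a.map fun e => (b.map fun f => crossing e f).sum).sum

end Intersection

/-! ### Multi-valued functions -/

section Multivalued

variable {S : Type*} [TopologicalSpace S] {T : Triangulation S}
  {E : Type*} [TopologicalSpace E] {p : E → S} {g : ℕ}

/-- `u` is a multi-valued function on vertices with periods `A`, `B`; here `dα k` and `dβ k` are
the deck transformations of the closed paths of the basis. -/
def IsMultivaluedOnVertices (dα dβ : Fin g → Deck p) (u : T.LiftedVertex p → ℝ)
    (A B : Fin g → ℝ) : Prop :=
  ∀ k z, u ((dα k).onVertex z) - u z = A k ∧ u ((dβ k).onVertex z) - u z = B k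

/-- `u'` is a multi-valued function on faces with periods `A`, `B`. -/
def IsMultivaluedOnFaces (dα dβ : Fin g → Deck p) (u' : T.LiftedFace p → ℝ)
    (A B : Fin g → ℝ) : Prop :=
  ∀ k w, u' ((dα k).onFace w) - u' w = A k ∧ u' ((dβ k).onFace w) - u' w = B k

end Multivalued

end BilinearIdentity

end

open scoped unitInterval

noncomputable section

namespace BilinearIdentity

/-! ### Covering spaces of triangulated surfaces -/

/-! Call the left-hand sum the pairing of `u` and `u'`, and let ω be the standard symplectic form on
period vectors. The pairing is bilinear. Summation by parts shows that it vanishes when one of the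
functions is invariant under the deck transformations and the other has periods
(`pairing_eq_zero_of_face_invariant`, `pairing_eq_zero_of_vertex_invariant`): differences of `u` sum
to zero around a face, and differences of `u'` sum to zero around a vertex. Hence the pairing
depends only on periods, and `u'` can be replaced by a vertex function `v` read at one corner of
each face.

The core is `sum_symplectic_eq_zero`, a discrete Stokes argument over the integers. Twice the
pairing of `u` and `v` is the sum over faces of the boundary integrals of 2u dv
(`two_mul_pairing_eq_sum_area`). When the total for a sum of two such forms is zero, these boundary
integrals are the coboundary of a cochain η on `T`. The form minus η is then closed on the simply
connected covering and has a primitive f. A deck transformation under which u has period a adds 2av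
plus a constant to f, so a commutator of basis elements adds twice the corresponding term of ω. The
surface relation makes these contributions cancel. Applied to a combination with zero pairing, this
gives pairing = m ω with one integer m for all pairs (`pairing_eq_mul_symplecticForm`).

The orientation determines m. A path through faces representing β_k has a dual vertex function,
whose period along α_k is the intersection number n. Its pairing with a function of period 1 along
β_k and 0 along the rest of the basis is 1, so mn = 1, and n > 0 forces m = 1. Functions with
prescribed integer periods exist by a dimension count using the Euler characteristic
(`exists_hasPeriods`). Real periods follow by expanding both functions in this integral basis. -/

instance : LocallyPathConnectedSpace Triangle :=
  (convex_stdSimplex ℝ (Fin 3)).locallyPathConnectedSpace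

instance : ContractibleSpace Triangle :=
  (convex_stdSimplex ℝ (Fin 3)).contractibleSpace ⟨_, (corner 0).2⟩

theorem _root_.IsLocalHomeomorph.locallyPathConnectedSpace {X Y : Type*} [TopologicalSpace X]
    [TopologicalSpace Y] [LocallyPathConnectedSpace Y] {f : X → Y} (hf : IsLocalHomeomorph f) :
    LocallyPathConnectedSpace X :=
  letI : ChartedSpace Y X :=
    { atlas := Set.univ
      chartAt := fun x => (hf x).choose
      mem_chart_source := fun x => (hf x).choose_spec.1
      chart_mem_atlas := fun _ => Set.mem_univ _ }
  ChartedSpace.locallyPathConnectedSpace Y X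

namespace Triangulation

variable {S : Type*} [TopologicalSpace S] {T : Triangulation S}
  {E : Type*} [TopologicalSpace E] {p : E → S}

theorem locallyPathConnectedSpace (T : Triangulation S) : LocallyPathConnectedSpace S :=
  haveI : LocallyPathConnectedSpace T.toGluing.Surface :=
    inferInstanceAs (LocallyPathConnectedSpace (Quot T.toGluing.Rel))
  T.homeo.symm.isOpenEmbedding.locallyPathConnectedSpace

theorem continuous_cell (T : Triangulation S) (w : T.Face) : Continuous (T.cell w) :=
  T.homeo.continuous.comp (continuous_quot_mk.comp continuous_sigmaMk)

theorem isOpen_of_cell {U : Set S} (h : ∀ w, IsOpen (T.cell w ⁻¹' U)) : IsOpen U := by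
  rw [← T.homeo.isOpen_preimage]
  refine isQuotientMap_quot_mk.isOpen_preimage.1 (isOpen_sigma_iff.2 fun w => ?_)
  exact h w

theorem cell_surjective (T : Triangulation S) (x : S) : ∃ w y, T.cell w y = x := by
  obtain ⟨⟨w, y⟩, h⟩ := Quot.exists_rep (T.homeo.symm x)
  exact ⟨w, y, by simp [cell, h]⟩

theorem cell_side (d : T.OrientedEdge) (t : I) :
    T.cell d.1 (side d.2 t) =
      T.cell (T.opp d).1 (side (T.opp d).2 (unitInterval.symm t)) :=
  congrArg T.homeo (Quot.sound (Gluing.Rel.glue d t))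

theorem exists_liftedFace (hp : IsCoveringMap p) {w : T.Face} {y : Triangle} {x : E}
    (h : p x = T.cell w y) : ∃ W : T.LiftedFace p, W.face = w ∧ W.map y = x := by
  obtain ⟨F, ⟨hF, hF'⟩, -⟩ :=
    hp.existsUnique_continuousMap_lifts ⟨T.cell w, T.continuous_cell w⟩ y x h
  exact ⟨⟨w, F, fun z => congrFun hF' z⟩, rfl, hF⟩

theorem liftedFace_ext (hp : IsCoveringMap p) {W W' : T.LiftedFace p} (hf : W.face = W'.face)
    {y : Triangle} (h : W.map y = W'.map y) : W = W' := by
  obtain ⟨w, F, hF⟩ := W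
  obtain ⟨w', F', hF'⟩ := W'
  obtain rfl : w = w' := hf
  have : (F : Triangle → E) = F' :=
    hp.eq_of_comp_eq F.continuous F'.continuous
      (funext fun z => (hF z).trans (hF' z).symm) y h
  simp only [LiftedFace.mk.injEq, true_and]
  exact DFunLike.coe_injective this

/-- The lifted oriented edge which is the `i`-th side of a lifted face on its left. -/
theorem exists_liftedEdge (hp : IsCoveringMap p) (W : T.LiftedFace p) (i : Fin 3) :
    ∃ e : T.LiftedEdge p, e.proj = (W.face, i) ∧ e.left = W := by
  have hc : ∀ t, T.cell W.face (side i t) = T.cell (T.opp (W.face, i)).1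
      (side (T.opp (W.face, i)).2 (unitInterval.symm t)) := cell_side (W.face, i)
  obtain ⟨W', hW', h0⟩ := exists_liftedFace (T := T) hp
    (x := W.map (side i 0)) ((W.lift _).trans (hc 0))
  refine ⟨⟨(W.face, i), W, W', rfl, hW', fun t => ?_⟩, rfl, rfl⟩
  have hside : Continuous (side i) := by
    refine Continuous.subtype_mk (continuous_pi fun j => ?_) _
    split_ifs <;> fun_prop
  have hside' : Continuous (side (T.opp (W.face, i)).2) := by
    refine Continuous.subtype_mk (continuous_pi fun j => ?_) _
    split_ifs <;> fun_prop
  have := hp.eq_of_comp_eq (g₁ := fun t => W.map (side i t))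
    (g₂ := fun t => W'.map (side (T.opp (W.face, i)).2 (unitInterval.symm t)))
    (W.map.continuous.comp hside)
    (W'.map.continuous.comp (hside'.comp unitInterval.continuous_symm))
    (funext fun t => by
      simp only [Function.comp_apply, W.lift, W'.lift, hW']
      exact hc t) 0 h0.symm
  exact congrFun this t

/-- The same lifted edge with the opposite orientation. -/
def LiftedEdge.flip (e : T.LiftedEdge p) : T.LiftedEdge p where
  proj := T.opp e.proj
  left := e.right
  right := e.left
  left_face := e.right_face
  right_face := by rw [T.opp_opp]; exact e.left_face
  adjacent t := by
    rw [T.opp_opp, e.adjacent, unitInterval.symm_symm]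

theorem LiftedEdge.flip_proj (e : T.LiftedEdge p) : e.flip.proj = T.opp e.proj := rfl

theorem LiftedFace.proj_vertex (W : T.LiftedFace p) (i : Fin 3) :
    p (W.vertex i).1 = T.cell W.face (corner i) := W.lift _

theorem LiftedEdge.right_vertex_add_one (e : T.LiftedEdge p) :
    e.right.vertex ((T.opp e.proj).2 + 1) = e.tail := by
  have h := e.adjacent 0
  rw [side_zero, unitInterval.symm_zero, side_one] at h
  exact Subtype.ext h.symm

theorem LiftedEdge.right_vertex (e : T.LiftedEdge p) :
    e.right.vertex (T.opp e.proj).2 = e.head := by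
  have h := e.adjacent 1
  rw [side_one, unitInterval.symm_one, side_zero] at h
  exact Subtype.ext h.symm

@[simp] theorem LiftedEdge.flip_tail (e : T.LiftedEdge p) : e.flip.tail = e.head :=
  e.right_vertex

@[simp] theorem LiftedEdge.flip_head (e : T.LiftedEdge p) : e.flip.head = e.tail :=
  e.right_vertex_add_one

/-- A family of functions on the lifted faces is compatible if the functions agree on common
sides. -/
def Compatible {Y : Type*} (φ : T.LiftedFace p → Triangle → Y) : Prop :=
  ∀ (e : T.LiftedEdge p) (t : I), φ e.left (side e.proj.2 t) =
    φ e.right (side (T.opp e.proj).2 (unitInterval.symm t))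

/-- Two parametrizations of a point of the covering project to points identified by a chain of
elementary gluings. Each gluing lifts to a crossing of a lifted edge at that same point, where
compatibility applies; in the transitive case a face over the intermediate triangle is lifted
through the point. -/
theorem Compatible.eq_of_map_eq (hp : IsCoveringMap p) {Y : Type*}
    {φ : T.LiftedFace p → Triangle → Y} (hφ : Compatible φ) {W W' : T.LiftedFace p}
    {y y' : Triangle} (h : W.map y = W'.map y') : φ W y = φ W' y' := by
  have key : ∀ a b : (Σ _ : T.Face, Triangle), Relation.EqvGen T.toGluing.Rel a b →
      ∀ (x : E) (W W' : T.LiftedFace p), W.face = a.1 → W'.face = b.1 → W.map a.2 = x →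
        W'.map b.2 = x → φ W a.2 = φ W' b.2 := by
    intro a b hab
    induction hab with
    | rel a b hab =>
      intro x W W' hW hW' hx hx'
      obtain ⟨d, t⟩ := hab
      obtain ⟨e, he, heW⟩ := exists_liftedEdge hp W d.2
      have hd : e.proj = d := by rw [he, hW]
      subst hd heW
      rw [hφ e t]
      have : e.right = W' := liftedFace_ext hp (e.right_face.trans hW'.symm)
        ((e.adjacent t).symm.trans (hx.trans hx'.symm))
      rw [this]
    | refl a =>
      intro x W W' hW hW' hx hx'
      rw [liftedFace_ext hp (hW.trans hW'.symm) (hx.trans hx'.symm)]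
    | symm a b _ ih =>
      intro x W W' hW hW' hx hx'
      exact (ih x W' W hW' hW hx' hx).symm
    | trans a b c hab _ ih ih' =>
      intro x W W' hW hW' hx hx'
      have hb : p x = T.cell b.1 b.2 := by
        rw [← hx, W.lift, hW]
        exact congrArg T.homeo (Quot.eqvGen_sound hab)
      obtain ⟨V, hV, hVx⟩ := exists_liftedFace hp hb
      exact (ih x W V hW hV hx hVx).trans (ih' x V W' hV hW' hVx hx')
  have hq : T.cell W.face y = T.cell W'.face y' := by rw [← W.lift, ← W'.lift, h]
  exact key ⟨W.face, y⟩ ⟨W'.face, y'⟩ (Quot.eqvGen_exact (T.homeo.injective hq)) _ W W' rfl rfl rfl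
    h.symm

theorem exists_liftedFace_map_eq (T : Triangulation S) (hp : IsCoveringMap p) (x : E) :
    ∃ (W : T.LiftedFace p) (y : Triangle), W.map y = x := by
  obtain ⟨w, y, h⟩ := T.cell_surjective (p x)
  obtain ⟨W, -, hW⟩ := exists_liftedFace hp h.symm
  exact ⟨W, y, hW⟩

/-- The covering space has the coherent topology with respect to the lifted faces. -/
theorem continuous_of_liftedFace (T : Triangulation S) (hp : IsCoveringMap p) {Y : Type*}
    [TopologicalSpace Y] {f : E → Y} (hf : ∀ W : T.LiftedFace p, Continuous fun y => f (W.map y)) :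
    Continuous f := by
  refine continuous_def.2 fun O hO => isOpen_iff_mem_nhds.2 fun x hx => ?_
  obtain ⟨e, hxe, he⟩ := hp.isLocalHomeomorph x
  -- Openness can be tested on cells only in `S`, so the part of the preimage in one sheet is pushed
  -- down; injectivity of `p` on the sheet brings it back.
  have hA : IsOpen (p '' (f ⁻¹' O ∩ e.source)) := by
    refine isOpen_of_cell (T := T) fun w => isOpen_iff_mem_nhds.2 fun y hy => ?_
    obtain ⟨x', ⟨hx', hx'e⟩, hxy⟩ := hy
    obtain ⟨W, rfl, hW⟩ := exists_liftedFace hp hxy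
    have h1 : IsOpen {y | f (W.map y) ∈ O} := hO.preimage (hf W)
    have h2 : IsOpen {y | W.map y ∈ e.source} := e.open_source.preimage W.map.continuous
    refine Filter.mem_of_superset ((h1.inter h2).mem_nhds ⟨?_, ?_⟩) fun z hz => ?_
    · simpa [hW] using hx'
    · simpa [hW] using hx'e
    · exact ⟨W.map z, ⟨hz.1, hz.2⟩, W.lift z⟩
  refine Filter.mem_of_superset (((hA.preimage hp.continuous).inter e.open_source).mem_nhds
    ⟨⟨x, ⟨hx, hxe⟩, rfl⟩, hxe⟩) fun z hz => ?_
  obtain ⟨⟨z', ⟨hz', hz'e⟩, hzz⟩, hze⟩ := hz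
  rw [he] at hzz
  rwa [← e.injOn hz'e hze hzz]

theorem Compatible.exists_map (hp : IsCoveringMap p) {Y : Type*}
    {φ : T.LiftedFace p → Triangle → Y} (hφ : Compatible φ) :
    ∃ f : E → Y, ∀ W y, f (W.map y) = φ W y := by
  choose W y h using T.exists_liftedFace_map_eq hp
  exact ⟨fun x => φ (W x) (y x), fun W' y' => hφ.eq_of_map_eq hp (h _)⟩

theorem Compatible.exists_continuousMap (hp : IsCoveringMap p) {Y : Type*} [TopologicalSpace Y]
    {φ : T.LiftedFace p → Triangle → Y} (hφ : Compatible φ) (hc : ∀ W, Continuous (φ W)) :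
    ∃ f : C(E, Y), ∀ W y, f (W.map y) = φ W y := by
  obtain ⟨f, hf⟩ := hφ.exists_map hp
  exact ⟨⟨f, T.continuous_of_liftedFace hp fun W => by simpa only [hf] using hc W⟩, hf⟩

/-- The dual graph of the covering triangulation is connected. -/
theorem liftedFace_constant [PreconnectedSpace E] (hp : IsCoveringMap p) {X : Type*}
    {n : T.LiftedFace p → X} (hn : ∀ e : T.LiftedEdge p, n e.left = n e.right)
    (W W' : T.LiftedFace p) : n W = n W' := by
  -- With the discrete topology, the glued function is continuous on a preconnected space, hence
  -- constant.
  let _ : TopologicalSpace X := ⊥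
  have : DiscreteTopology X := ⟨rfl⟩
  obtain ⟨f, hf⟩ := Compatible.exists_continuousMap hp (T := T) (φ := fun W _ => n W)
    (fun e _ => hn e) (fun _ => continuous_const)
  rw [← hf W (corner 0), ← hf W' (corner 0)]
  exact PreconnectedSpace.constant ‹_› f.continuous

theorem exists_vertex_eq (hp : IsCoveringMap p) (z : T.LiftedVertex p) :
    ∃ (W : T.LiftedFace p) (i : Fin 3), W.vertex i = z := by
  obtain ⟨w, i, h⟩ := z.2
  obtain ⟨W, -, hW⟩ := exists_liftedFace hp h
  exact ⟨W, i, Subtype.ext hW⟩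

/-- The 1-skeleton of the covering triangulation is connected. -/
theorem liftedVertex_constant [PreconnectedSpace E] (hp : IsCoveringMap p) {X : Type*}
    {u : T.LiftedVertex p → X} (hu : ∀ (W : T.LiftedFace p) i, u (W.vertex (i + 1)) = u (W.vertex i))
    (z z' : T.LiftedVertex p) : u z = u z' := by
  have h0 : ∀ (W : T.LiftedFace p) i, u (W.vertex i) = u (W.vertex 0) := by
    intro W i
    have h1 := hu W 0
    have h2 := hu W 1
    fin_cases i
    · rfl
    · exact h1
    · exact h2.trans h1
  obtain ⟨W, i, rfl⟩ := exists_vertex_eq hp z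
  obtain ⟨W', i', rfl⟩ := exists_vertex_eq hp z'
  rw [h0, h0 W']
  refine liftedFace_constant hp (n := fun W => u (W.vertex 0)) (fun e => ?_) W W'
  rw [← h0 e.left e.proj.2, ← h0 e.right ((T.opp e.proj).2 + 1), e.right_vertex_add_one]
  rfl

/-- Closed integer cochains on a simply connected covering triangulation are exact. -/
theorem exists_primitive [SimplyConnectedSpace E] (hp : IsCoveringMap p)
    (ξ : T.LiftedFace p → Fin 3 → ℤ) (hclosed : ∀ W, ξ W 0 + ξ W 1 + ξ W 2 = 0)
    (hflip : ∀ e : T.LiftedEdge p, ξ e.left e.proj.2 = -ξ e.right (T.opp e.proj).2) :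
    ∃ u : T.LiftedVertex p → ℤ, ∀ W i, u (W.vertex (i + 1)) - u (W.vertex i) = ξ W i := by
  have := T.locallyPathConnectedSpace
  have : LocallyPathConnectedSpace E := hp.isLocalHomeomorph.locallyPathConnectedSpace
  -- A primitive on each face separately, normalized at corner 0 and then extended affinely. On a
  -- common side two such extensions differ by an integer constant, so modulo 1 they glue to a map
  -- into the circle.
  let c : T.LiftedFace p → Fin 3 → ℤ := fun W => ![0, ξ W 0, ξ W 0 + ξ W 1]
  have hc : ∀ W i, c W (i + 1) - c W i = ξ W i := by
    intro W i
    have := hclosed W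
    fin_cases i <;> (simp [c]; try omega)
  let f : T.LiftedFace p → Triangle → ℝ := fun W y => ∑ i, y.1 i * c W i
  have hfc : ∀ W, Continuous (f W) := fun W => by
    refine continuous_finsetSum _ fun i _ => Continuous.mul ?_ continuous_const
    exact (continuous_apply i).comp continuous_subtype_val
  have hside : ∀ W i (t : I), f W (side i t) = (1 - t) * c W i + t * c W (i + 1) := by
    intro W i t
    fin_cases i <;> (simp [f, side, Fin.sum_univ_three]; try ring)
  have hcorner : ∀ W i, f W (corner i) = c W i := by
    intro W i
    rw [← side_zero, hside]
    simp
  have hcompat : Compatible fun W y => (f W y : AddCircle (1 : ℝ)) := by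
    intro e t
    have h1 := hc e.left e.proj.2
    have h2 := hc e.right (T.opp e.proj).2
    have h3 := hflip e
    rw [← sub_eq_zero, ← AddCircle.coe_sub, AddCircle.coe_eq_zero_iff]
    refine ⟨c e.left e.proj.2 - c e.right ((T.opp e.proj).2 + 1), ?_⟩
    have h4 : c e.left (e.proj.2 + 1) = c e.left e.proj.2 + ξ e.left e.proj.2 := by omega
    have h5 : c e.right (T.opp e.proj).2 =
      c e.right ((T.opp e.proj).2 + 1) + ξ e.left e.proj.2 := by omega
    rw [hside, hside, h4, h5, unitInterval.coe_symm_eq]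
    simp only [zsmul_eq_mul]
    push_cast
    ring
  obtain ⟨Φ, hΦ⟩ := hcompat.exists_continuousMap hp
    (fun W => (AddCircle.continuous_mk' 1).comp (hfc W))
  obtain ⟨x₀⟩ : Nonempty E := inferInstance
  obtain ⟨r, hr⟩ := QuotientAddGroup.mk_surjective (Φ x₀)
  -- Simple connectedness enters here: the circle-valued map lifts to the reals. The lift differs
  -- from each facewise primitive by a constant integer, once the lift is started at a real
  -- representative of the value at `x₀`.
  obtain ⟨F, ⟨-, hF⟩, -⟩ := (AddCircle.isCoveringMap_coe (1 : ℝ)).existsUnique_continuousMap_lifts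
    Φ x₀ r hr
  have hF' : ∀ x, (F x : AddCircle (1 : ℝ)) = Φ x := fun x => congrFun hF x
  have hFW : ∀ W : T.LiftedFace p, ∃ n : ℤ, ∀ y, F (W.map y) = f W y + n := by
    intro W
    have h0 : ((F (W.map (corner 0)) - f W (corner 0) : ℝ) : AddCircle (1 : ℝ)) = 0 := by
      rw [AddCircle.coe_sub, hF', hΦ, sub_self]
    obtain ⟨n, hn⟩ := (AddCircle.coe_eq_zero_iff (1 : ℝ)).1 h0
    refine ⟨n, congrFun ((AddCircle.isCoveringMap_coe (1 : ℝ)).eq_of_comp_eq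
      (g₁ := fun y => F (W.map y)) (g₂ := fun y => f W y + n)
      (F.continuous.comp W.map.continuous) ((hfc W).add continuous_const)
      (funext fun y => ?_) (corner 0) ?_)⟩
    · simp only [Function.comp_apply, AddCircle.coe_add, hF', hΦ]
      have : ((n : ℝ) : AddCircle (1 : ℝ)) = 0 := (AddCircle.coe_eq_zero_iff (1 : ℝ)).2 ⟨n, by simp⟩
      rw [this, add_zero]
    · simp only [zsmul_eq_mul, mul_one] at hn
      simp only [hn]; ring
  have hv : ∀ z : T.LiftedVertex p, ∃ m : ℤ, F z.1 = m := by
    intro z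
    obtain ⟨W, i, rfl⟩ := exists_vertex_eq hp z
    obtain ⟨n, hn⟩ := hFW W
    exact ⟨c W i + n, by rw [LiftedFace.vertex, hn, hcorner]; push_cast; ring⟩
  choose u hu using hv
  refine ⟨u, fun W i => ?_⟩
  obtain ⟨n, hn⟩ := hFW W
  have : ∀ i, u (W.vertex i) = c W i + n := by
    intro i
    have h := hu (W.vertex i)
    rw [LiftedFace.vertex, hn, hcorner] at h
    exact_mod_cast h.symm
  rw [this, this, ← hc]
  ring

end Triangulation

/-! ### Deck transformations and monodromy -/

namespace Deck

theorem ext_apply {S E : Type*} [TopologicalSpace E] {p : E → S} {d d' : Deck p} (h : ∀ z, d.toHomeo z = d'.toHomeo z) : d = d' := by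
  obtain ⟨d, _⟩ := d
  obtain ⟨d', _⟩ := d'
  obtain rfl : d = d' := Homeomorph.ext h
  rfl

variable {S E : Type*} [TopologicalSpace S] [TopologicalSpace E] {p : E → S}

instance : Group (Deck p) where
  mul d d' := ⟨d'.toHomeo.trans d.toHomeo, fun z => (d.proj _).trans (d'.proj z)⟩
  one := ⟨Homeomorph.refl E, fun _ => rfl⟩
  inv d := ⟨d.toHomeo.symm, fun z => by rw [← d.proj, Homeomorph.apply_symm_apply]⟩
  mul_assoc _ _ _ := rfl
  one_mul _ := rfl
  mul_one _ := rfl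
  inv_mul_cancel d := ext_apply fun z => d.toHomeo.symm_apply_apply z

theorem eq_of_apply_eq [PreconnectedSpace E] (hp : IsCoveringMap p) {d d' : Deck p} {z : E}
    (h : d.toHomeo z = d'.toHomeo z) : d = d' :=
  ext_apply (congrFun (hp.eq_of_comp_eq d.toHomeo.continuous d'.toHomeo.continuous
    (funext fun x => (d.proj x).trans (d'.proj x).symm) z h))

/-- The action on a fibre. -/
def onFibre (d : Deck p) {x : S} (z : p ⁻¹' {x}) : p ⁻¹' {x} :=
  ⟨d.toHomeo z.1, (d.proj _).trans z.2⟩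

/-- A deck transformation carries a lift of a path to a lift of the same path, and lifts are unique.
-/
theorem monodromy_onFibre (hp : IsCoveringMap p) (d : Deck p) {x y : S}
    (γ : Path.Homotopic.Quotient x y) (z : p ⁻¹' {x}) :
    hp.monodromy γ (d.onFibre z) = d.onFibre (hp.monodromy γ z) := by
  obtain ⟨γ⟩ := γ
  refine Subtype.ext ?_
  have h0 : γ.toContinuousMap 0 = p z.1 := γ.source.trans z.2.symm
  have := (hp.eq_liftPath_iff' (γ := γ.toContinuousMap) (e := d.toHomeo z.1)
    (h0.trans (d.proj _).symm)
    (Γ := ⟨fun t => d.toHomeo (hp.liftPath γ.toContinuousMap z.1 h0 t), by fun_prop⟩)).2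
    ⟨funext fun t => (d.proj _).trans (congrFun (hp.liftPath_lifts γ.toContinuousMap z.1 h0) t),
      congrArg d.toHomeo (hp.liftPath_zero γ.toContinuousMap z.1 h0)⟩
  exact (DFunLike.congr_fun this 1).symm

/-- The deck transformation `d` is determined by the class `γ` in the fundamental group. -/
def Represents (hp : IsCoveringMap p) (z₀ : E) (d : Deck p)
    (γ : Path.Homotopic.Quotient (p z₀) (p z₀)) : Prop :=
  hp.monodromy γ ⟨z₀, rfl⟩ = d.onFibre ⟨z₀, rfl⟩

theorem IsOf.represents (hp : IsCoveringMap p) {z₀ : E} {d : Deck p} {γ : Path (p z₀) (p z₀)}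
    (h : d.IsOf γ) : d.Represents hp z₀ (.mk γ) := by
  obtain ⟨Γ, hΓ⟩ := h
  refine Subtype.ext ?_
  have := (hp.eq_liftPath_iff' (γ := γ.toContinuousMap) (e := z₀) γ.source
    (Γ := Γ.toContinuousMap)).2 ⟨funext hΓ, Γ.source⟩
  exact (DFunLike.congr_fun this 1).symm.trans Γ.target

theorem Represents.refl (hp : IsCoveringMap p) (z₀ : E) :
    (1 : Deck p).Represents hp z₀ (.refl _) := by
  rw [Represents, hp.monodromy_refl]
  rfl

/-- The second path is lifted from `d z₀`, and its endpoint is `d (d' z₀)` since deck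
transformations commute with monodromy. Thus concatenation corresponds to the product in the same
order. -/
theorem Represents.trans {hp : IsCoveringMap p} {z₀ : E} {d d' : Deck p}
    {γ γ' : Path.Homotopic.Quotient (p z₀) (p z₀)} (h : d.Represents hp z₀ γ)
    (h' : d'.Represents hp z₀ γ') : (d * d').Represents hp z₀ (γ.trans γ') := by
  rw [Represents, hp.monodromy_trans_apply, h, monodromy_onFibre, h']
  rfl

theorem Represents.symm {hp : IsCoveringMap p} {z₀ : E} {d : Deck p}
    {γ : Path.Homotopic.Quotient (p z₀) (p z₀)} (h : d.Represents hp z₀ γ) :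
    d⁻¹.Represents hp z₀ γ.symm := by
  have h1 : hp.monodromy γ (d⁻¹.onFibre ⟨z₀, rfl⟩) = ⟨z₀, rfl⟩ := by
    rw [monodromy_onFibre, h]
    exact Subtype.ext (d.toHomeo.symm_apply_apply z₀)
  have h2 : γ.trans γ.symm = .refl _ := by
    induction γ using Path.Homotopic.Quotient.ind with
    | mk γ => exact Path.Homotopic.Quotient.eq.2 ⟨(Path.Homotopy.reflTransSymm γ).symm⟩
  have h3 := hp.monodromy_trans_apply γ γ.symm (d⁻¹.onFibre ⟨z₀, rfl⟩)
  rw [h2, hp.monodromy_refl, h1] at h3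
  exact h3.symm

variable {g : ℕ} {z₀ : E} {α β : Fin g → Path (p z₀) (p z₀)} {dα dβ : Fin g → Deck p}

/-- The deck transformations of a standard basis act transitively on the fibres. -/
theorem exists_mem_closure_apply_eq [PathConnectedSpace E] (hp : IsCoveringMap p)
    (hαβ : IsStandardBasis α β) (hα : ∀ k, (dα k).IsOf (α k)) (hβ : ∀ k, (dβ k).IsOf (β k))
    {z z' : E} (h : p z = p z') :
    ∃ d ∈ Subgroup.closure (Set.range dα ∪ Set.range dβ), d.toHomeo z = z' := by
  have key : ∀ x : FundamentalGroup S (p z₀),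
      ∃ d ∈ Subgroup.closure (Set.range dα ∪ Set.range dβ), d.Represents hp z₀ x := by
    intro x
    have hx : x ∈ Subgroup.closure
        (Set.range (fun k => loopClass (α k)) ∪ Set.range (fun k => loopClass (β k))) := by
      rw [hαβ.generate]; trivial
    induction hx using Subgroup.closure_induction with
    | mem x hx =>
      rcases hx with ⟨k, rfl⟩ | ⟨k, rfl⟩
      · exact ⟨dα k, Subgroup.subset_closure (.inl ⟨k, rfl⟩), (hα k).represents hp⟩
      · exact ⟨dβ k, Subgroup.subset_closure (.inr ⟨k, rfl⟩), (hβ k).represents hp⟩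
    | one => exact ⟨1, one_mem _, Represents.refl hp z₀⟩
    | mul x y _ _ hx hy =>
      obtain ⟨d, hd, hdx⟩ := hx
      obtain ⟨d', hd', hdy⟩ := hy
      -- The product `x * y` in `FundamentalGroup` is `y` followed by `x`, hence the reversed order.
      exact ⟨d' * d, mul_mem hd' hd, hdy.trans hdx⟩
    | inv x _ hx =>
      obtain ⟨d, hd, hdx⟩ := hx
      exact ⟨d⁻¹, inv_mem hd, hdx.symm⟩
  -- The question is transported to the fibre of `z₀`: `z₁` is the point whose monodromy along the
  -- projection of `P` is `z'`. A deck transformation taking `z₀` to `z₁` then takes `z` to `z'`.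
  obtain ⟨P⟩ := PathConnectedSpace.joined z₀ z
  let γ : Path.Homotopic.Quotient (p z₀) (p z) := (Path.Homotopic.Quotient.mk P).map ⟨p, hp.continuous⟩
  have hγ : hp.monodromy γ ⟨z₀, rfl⟩ = ⟨z, rfl⟩ := hp.monodromy_map _
  obtain ⟨z₁, hz₁⟩ := (hp.monodromy_bijective γ).2 ⟨z', h.symm⟩
  obtain ⟨Q⟩ := PathConnectedSpace.joined z₀ z₁.1
  have hz₁' : p z₁.1 = p z₀ := z₁.2
  obtain ⟨d, hd, hdQ⟩ := key (((Path.Homotopic.Quotient.mk Q).map ⟨p, hp.continuous⟩).cast rfl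
    hz₁'.symm)
  have hQ := hp.monodromy_eq_of_map_eq (γ := ((Path.Homotopic.Quotient.mk Q).map
    ⟨p, hp.continuous⟩).cast rfl hz₁'.symm) (ex := ⟨z₀, rfl⟩) (ey := z₁)
    (Path.Homotopic.Quotient.mk Q) rfl
  refine ⟨d, hd, ?_⟩
  have h1 : z₁ = d.onFibre ⟨z₀, rfl⟩ := hQ.symm.trans hdQ
  rw [h1, monodromy_onFibre, hγ] at hz₁
  exact congrArg Subtype.val hz₁

theorem prod_commutator_eq_one [PreconnectedSpace E] (hp : IsCoveringMap p)
    (hαβ : IsStandardBasis α β) (hα : ∀ k, (dα k).IsOf (α k)) (hβ : ∀ k, (dβ k).IsOf (β k)) :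
    (List.ofFn fun k => dα k * dβ k * (dα k)⁻¹ * (dβ k)⁻¹).prod = 1 := by
  have key : ∀ l : List (Fin g),
      (l.map fun k => dα k * dβ k * (dα k)⁻¹ * (dβ k)⁻¹).prod.Represents hp z₀
        (.mk ((l.map fun k => commutatorLoop (α k) (β k)).foldr Path.trans (Path.refl _))) := by
    intro l
    induction l with
    | nil => exact Represents.refl hp z₀
    | cons k l ih =>
      rw [List.map_cons, List.prod_cons]
      have ha := (hα k).represents hp
      have hb := (hβ k).represents hp
      exact (((ha.trans hb).trans ha.symm).trans hb.symm).trans ih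
  have h := key (List.finRange g)
  rw [← List.ofFn_eq_map, ← List.ofFn_eq_map] at h
  have h1 := Path.Homotopic.Quotient.eq.2 hαβ.relator
  rw [relatorLoop] at h1
  rw [h1] at h
  exact eq_of_apply_eq hp (congrArg Subtype.val (Eq.trans (Eq.symm h) (Represents.refl hp z₀)))

end Deck

/-! ### Equivariant functions and the pairing -/

section Pairing

variable {S : Type*} [TopologicalSpace S] {T : Triangulation S}
  {E : Type*} [TopologicalSpace E] {p : E → S}

open Triangulation

instance : MulAction (Deck p) (T.LiftedVertex p) where
  smul d z := d.onVertex z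
  one_smul _ := rfl
  mul_smul _ _ _ := rfl

instance : MulAction (Deck p) (T.LiftedFace p) where
  smul d w := d.onFace w
  one_smul _ := rfl
  mul_smul _ _ _ := rfl

theorem smul_vertex (d : Deck p) (W : T.LiftedFace p) (i : Fin 3) :
    (d • W).vertex i = d • W.vertex i := rfl

/-- Every element of `H` changes the function `f` by a constant. -/
def HasPeriods {G X R : Type*} [Group G] [MulAction G X] [Add R] (H : Subgroup G) (f : X → R) :
    Prop :=
  ∀ d ∈ H, ∃ a, ∀ x, f (d • x) = f x + a

theorem hasPeriods_closure {G X R : Type*} [Group G] [MulAction G X] [AddCommGroup R] {s : Set G}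
    {f : X → R} (h : ∀ d ∈ s, ∃ a, ∀ x, f (d • x) = f x + a) :
    HasPeriods (Subgroup.closure s) f := by
  intro d hd
  induction hd using Subgroup.closure_induction with
  | mem d hd => exact h d hd
  | one => exact ⟨0, fun x => by simp⟩
  | mul d d' _ _ hd hd' =>
    obtain ⟨a, ha⟩ := hd
    obtain ⟨a', ha'⟩ := hd'
    exact ⟨a' + a, fun x => by rw [mul_smul, ha, ha', add_assoc]⟩
  | inv d _ hd =>
    obtain ⟨a, ha⟩ := hd
    exact ⟨-a, fun x => by rw [← sub_eq_add_neg, eq_sub_iff_add_eq, ← ha, smul_inv_smul]⟩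

theorem invariant_closure {G X Y : Type*} [Group G] [MulAction G X] {s : Set G}
    {f : X → Y} (h : ∀ d ∈ s, ∀ x, f (d • x) = f x) :
    ∀ d ∈ Subgroup.closure s, ∀ x, f (d • x) = f x := by
  intro d hd
  induction hd using Subgroup.closure_induction with
  | mem d hd => exact h d hd
  | one => exact fun x => by simp
  | mul d d' _ _ hd hd' => exact fun x => by rw [mul_smul, hd, hd']
  | inv d _ hd => exact fun x => by rw [← hd, smul_inv_smul]

/-- The group `H` of deck transformations acts transitively on the fibres. -/
def FibreTransitive (H : Subgroup (Deck p)) : Prop :=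
  ∀ z z' : E, p z = p z' → ∃ d ∈ H, d.toHomeo z = z'

variable {H : Subgroup (Deck p)}

theorem FibreTransitive.exists_smul_face (hH : FibreTransitive H) (hp : IsCoveringMap p)
    {W W' : T.LiftedFace p} (h : W.face = W'.face) : ∃ d ∈ H, d • W = W' := by
  obtain ⟨d, hd, hz⟩ := hH (W.map (corner 0)) (W'.map (corner 0)) (by rw [W.lift, W'.lift, h])
  exact ⟨d, hd, liftedFace_ext hp (W := d • W) h hz⟩

theorem FibreTransitive.exists_smul_edge (hH : FibreTransitive H) (hp : IsCoveringMap p)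
    {e e' : T.LiftedEdge p} (h : e.proj = e'.proj) :
    ∃ d ∈ H, d • e.left = e'.left ∧ d • e.right = e'.right := by
  obtain ⟨d, hd, hz⟩ := hH.exists_smul_face hp (W := e.left) (W' := e'.left)
    (by rw [e.left_face, e'.left_face, h])
  refine ⟨d, hd, hz, liftedFace_ext hp (W := d • e.right)
    (y := side (T.opp e.proj).2 (unitInterval.symm 0)) ?_ ?_⟩
  · exact (e.right_face.trans (by rw [h])).trans e'.right_face.symm
  · rw [h, ← e'.adjacent, ← hz]
    change d.toHomeo (e.right.map _) = d.toHomeo (e.left.map _)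
    rw [← h, e.adjacent]

section

variable {R : Type*} [CommRing R] {u v : T.LiftedVertex p → R} {u' : T.LiftedFace p → R}

theorem HasPeriods.vertex_sub (hu : HasPeriods H u) (hH : FibreTransitive H)
    (hp : IsCoveringMap p) {W W' : T.LiftedFace p} (h : W.face = W'.face) (i j : Fin 3) :
    u (W.vertex i) - u (W.vertex j) = u (W'.vertex i) - u (W'.vertex j) := by
  obtain ⟨d, hd, rfl⟩ := hH.exists_smul_face hp h
  obtain ⟨a, ha⟩ := hu d hd
  rw [smul_vertex, smul_vertex, ha, ha]
  ring

theorem HasPeriods.edge_sub (hu : HasPeriods H u) (hH : FibreTransitive H)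
    (hp : IsCoveringMap p) {e e' : T.LiftedEdge p} (h : e.proj = e'.proj) :
    u e.head - u e.tail = u e'.head - u e'.tail := by
  rw [LiftedEdge.head, LiftedEdge.tail, LiftedEdge.head, LiftedEdge.tail, ← h]
  exact hu.vertex_sub hH hp (by rw [e.left_face, e'.left_face, h]) _ _

theorem HasPeriods.face_sub (hu' : HasPeriods H u') (hH : FibreTransitive H)
    (hp : IsCoveringMap p) {e e' : T.LiftedEdge p} (h : e.proj = e'.proj) :
    u' e.left - u' e.right = u' e'.left - u' e'.right := by
  obtain ⟨d, hd, h1, h2⟩ := hH.exists_smul_edge hp h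
  obtain ⟨a, ha⟩ := hu' d hd
  rw [← h1, ← h2, ha, ha]
  ring

theorem HasPeriods.comp_vertex (hv : HasPeriods H v) :
    HasPeriods H fun W : T.LiftedFace p => v (W.vertex 0) := by
  intro d hd
  obtain ⟨a, ha⟩ := hv d hd
  exact ⟨a, fun W => ha (W.vertex 0)⟩

/-- The sum in the bilinear identity. -/
def pairing (c : T.Edge → T.LiftedEdge p) (u : T.LiftedVertex p → R) (u' : T.LiftedFace p → R) :
    R :=
  ∑ e : T.Edge, (u' (c e).left - u' (c e).right) * (u (c e).head - u (c e).tail)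

theorem edge_eq_iff {d d' : T.OrientedEdge} : d.edge = d'.edge ↔ d' = d ∨ d' = T.opp d := by
  constructor
  · intro h
    replace h := Quot.eqvGen_exact h
    induction h with
    | rel a b h => exact .inr h
    | refl a => exact .inl rfl
    | symm a b _ ih =>
      rcases ih with rfl | rfl
      · exact .inl rfl
      · exact .inr (T.opp_opp _).symm
    | trans a b c _ _ ih ih' =>
      rcases ih with rfl | rfl <;> rcases ih' with rfl | rfl
      · exact .inl rfl
      · exact .inr rfl
      · exact .inr rfl
      · exact .inl (T.opp_opp _)
  · rintro (rfl | rfl)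
    · rfl
    · exact Quot.sound rfl

/-- The permutation of the oriented edges reversing the orientation. -/
def oppEquiv (T : Triangulation S) : Equiv.Perm T.OrientedEdge :=
  ⟨T.opp, T.opp, T.opp_opp, T.opp_opp⟩

/-- The permutation of the oriented edges taking each of them to the next one around its tail. -/
def nextEquiv (T : Triangulation S) : Equiv.Perm T.OrientedEdge :=
  (oppEquiv T).trans ((Equiv.refl _).prodCongr (Equiv.addRight 1))

theorem sum_opp (f : T.OrientedEdge → R) : ∑ d, f (T.opp d) = ∑ d, f d :=
  Equiv.sum_comp (oppEquiv T) f

theorem sum_next (f : T.OrientedEdge → R) :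
    ∑ d : T.OrientedEdge, f ((T.opp d).1, (T.opp d).2 + 1) = ∑ d, f d :=
  Equiv.sum_comp (nextEquiv T) f

/-! ### Summation over oriented edges and summation by parts -/

variable {c : T.Edge → T.LiftedEdge p}
  (hc : ∀ e, OrientedEdge.edge (c e).proj = e)

include hc in
theorem sum_orientedEdge {f : T.OrientedEdge → R} (hf : ∀ d, f (T.opp d) = f d) :
    ∑ d, f d = 2 * ∑ e, f (c e).proj := by
  classical
  rw [Finset.mul_sum, ← Finset.sum_fiberwise (s := Finset.univ)
    (g := fun d : T.OrientedEdge => d.edge)]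
  refine Finset.sum_congr rfl fun e _ => ?_
  have : Finset.univ.filter (fun d : T.OrientedEdge => d.edge = e) =
      {(c e).proj, T.opp (c e).proj} := by
    ext d
    rw [Finset.mem_filter, Finset.mem_insert, Finset.mem_singleton]
    conv_lhs => rw [← hc e]
    rw [eq_comm (a := d.edge), edge_eq_iff]
    simp
  rw [this, Finset.sum_pair (T.opp_ne _).symm, hf, two_mul]

include hc in
theorem exists_liftedEdge_proj (d : T.OrientedEdge) : ∃ e : T.LiftedEdge p, e.proj = d := by
  rcases edge_eq_iff.1 (hc d.edge) with h | h
  · exact ⟨_, h.symm⟩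
  · exact ⟨(c d.edge).flip, h.symm⟩

include hc in
theorem exists_face_section : ∃ s : T.Face → T.LiftedFace p, ∀ w, (s w).face = w := by
  choose e he using fun w => exists_liftedEdge_proj hc (w, (0 : Fin 3))
  exact ⟨fun w => (e w).left, fun w => by rw [(e w).left_face, he]⟩

include hc in
-- Periods cancel in both differences, so the lift of an edge is immaterial; reversing the edge
-- changes the sign of both differences, so the two orientations contribute equally.
theorem two_mul_pairing (hH : FibreTransitive H) (hp : IsCoveringMap p)
    (hu : HasPeriods H u) (hu' : HasPeriods H u') {e : T.OrientedEdge → T.LiftedEdge p}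
    (he : ∀ d, (e d).proj = d) :
    2 * pairing c u u' =
      ∑ d, (u' (e d).left - u' (e d).right) * (u (e d).head - u (e d).tail) := by
  rw [sum_orientedEdge hc]
  · congr 1
    refine Finset.sum_congr rfl fun x _ => ?_
    rw [hu'.face_sub hH hp (he (c x).proj).symm, hu.edge_sub hH hp (he (c x).proj).symm]
  · intro d
    have h : (e (T.opp d)).proj = (e d).flip.proj := by rw [he, LiftedEdge.flip_proj, he]
    rw [hu'.face_sub hH hp h, hu.edge_sub hH hp h, LiftedEdge.flip_head, LiftedEdge.flip_tail]
    simp only [LiftedEdge.flip]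
    ring

theorem exists_edge_section (hp : IsCoveringMap p) {s : T.Face → T.LiftedFace p}
    (hs : ∀ w, (s w).face = w) :
    ∃ e : T.OrientedEdge → T.LiftedEdge p, ∀ d, (e d).proj = d ∧ (e d).left = s d.1 := by
  choose e he using fun d : T.OrientedEdge => exists_liftedEdge hp (s d.1) d.2
  exact ⟨e, fun d => ⟨by rw [(he d).1, hs], (he d).2⟩⟩

theorem head_eq_of_section {s : T.Face → T.LiftedFace p} {d : T.OrientedEdge} {e : T.LiftedEdge p}
    (h : e.proj = d ∧ e.left = s d.1) : e.head = (s d.1).vertex (d.2 + 1) := by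
  rw [LiftedEdge.head, h.2, h.1]

theorem tail_eq_of_section {s : T.Face → T.LiftedFace p} {d : T.OrientedEdge} {e : T.LiftedEdge p}
    (h : e.proj = d ∧ e.left = s d.1) : e.tail = (s d.1).vertex d.2 := by
  rw [LiftedEdge.tail, h.2, h.1]

/-- Twice the integral of `u dv` along the boundary of a face. -/
def area (u v : T.LiftedVertex p → R) (W : T.LiftedFace p) : R :=
  ∑ i, (u (W.vertex i) + u (W.vertex (i + 1))) * (v (W.vertex (i + 1)) - v (W.vertex i))

include hc in
-- Subtracting the mean value of `v` on the edge from its values at the chosen corners of the two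
-- shores makes the edge terms separate into one term per face. The corner value then drops out,
-- since the differences of `u` around a face sum to zero, and Abel summation exchanges `u` and `v`.
theorem two_mul_pairing_eq_sum_area [IsDomain R] [CharZero R] (hH : FibreTransitive H)
    (hp : IsCoveringMap p) (hu : HasPeriods H u) (hv : HasPeriods H v)
    {s : T.Face → T.LiftedFace p} (hs : ∀ w, (s w).face = w) :
    2 * pairing c u (fun W => v (W.vertex 0)) = ∑ w, area u v (s w) := by
  obtain ⟨e, he⟩ := exists_edge_section hp hs
  rw [two_mul_pairing hc hH hp hu hv.comp_vertex (fun d => (he d).1)]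
  let f : T.OrientedEdge → R := fun d => (2 * v ((e d).left.vertex 0) - v (e d).head -
    v (e d).tail) * (u (e d).head - u (e d).tail)
  have hf : ∀ d, f (T.opp d) = -((2 * v ((e d).right.vertex 0) - v (e d).head -
      v (e d).tail) * (u (e d).head - u (e d).tail)) := by
    intro d
    have h : (e (T.opp d)).proj = (e d).flip.proj := by
      rw [(he _).1, LiftedEdge.flip_proj, (he d).1]
    obtain ⟨t, ht, h1, -⟩ := hH.exists_smul_edge hp h.symm
    obtain ⟨a, ha⟩ := hv t ht
    have h2 : (e (T.opp d)).head = t • (e d).tail := by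
      rw [LiftedEdge.head, ← h1, smul_vertex, h]
      exact congrArg (t • ·) (e d).flip_head
    have h3 : (e (T.opp d)).tail = t • (e d).head := by
      rw [LiftedEdge.tail, ← h1, smul_vertex, h]
      exact congrArg (t • ·) (e d).flip_tail
    simp only [f]
    rw [hu.edge_sub hH hp h, h2, h3, ← h1, smul_vertex, ha, ha, ha, LiftedEdge.flip_head,
      LiftedEdge.flip_tail]
    simp only [LiftedEdge.flip]
    ring
  have h2 : ∑ d, (v ((e d).left.vertex 0) - v ((e d).right.vertex 0)) *
      (u (e d).head - u (e d).tail) = ∑ d, f d := by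
    refine mul_left_cancel₀ (two_ne_zero (α := R)) ?_
    rw [two_mul (∑ d, f d)]
    nth_rw 2 [← sum_opp f]
    rw [← Finset.sum_add_distrib, Finset.mul_sum]
    refine Finset.sum_congr rfl fun d _ => ?_
    rw [hf]
    simp only [f]
    ring
  rw [h2, Fintype.sum_prod_type]
  refine Finset.sum_congr rfl fun w _ => ?_
  have h3 : ∀ i, f (w, i) = (2 * v ((s w).vertex 0) - v ((s w).vertex (i + 1)) -
      v ((s w).vertex i)) * (u ((s w).vertex (i + 1)) - u ((s w).vertex i)) := by
    intro i
    simp only [f]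
    rw [head_eq_of_section (he _), tail_eq_of_section (he _), (he _).2]
  simp only [h3, area, Fin.sum_univ_three]
  have h4 : (2 : Fin 3) + 1 = 0 := rfl
  have h5 : (1 : Fin 3) + 1 = 2 := rfl
  rw [h4, h5, zero_add]
  ring

include hc in
theorem pairing_eq_zero_of_face_invariant [IsDomain R] [CharZero R] (hH : FibreTransitive H)
    (hp : IsCoveringMap p) (hu : HasPeriods H u)
    (hu' : ∀ d ∈ H, ∀ W : T.LiftedFace p, u' (d • W) = u' W) : pairing c u u' = 0 := by
  obtain ⟨s, hs⟩ := exists_face_section hc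
  obtain ⟨e, he⟩ := exists_edge_section hp hs
  have hinv : ∀ W, u' W = u' (s W.face) := by
    intro W
    obtain ⟨d, hd, h⟩ := hH.exists_smul_face hp (hs W.face).symm
    rw [← h, hu' d hd]
  have hu'' : HasPeriods H u' := fun d hd => ⟨0, fun W => by rw [hu' d hd, add_zero]⟩
  refine mul_left_cancel₀ (two_ne_zero (α := R)) ?_
  rw [two_mul_pairing hc hH hp hu hu'' (fun d => (he d).1), mul_zero]
  let f : T.OrientedEdge → R := fun d => u' (s d.1) * (u (e d).head - u (e d).tail)
  have hf : ∀ d, f (T.opp d) = -(u' (e d).right * (u (e d).head - u (e d).tail)) := by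
    intro d
    have h : (e (T.opp d)).proj = (e d).flip.proj := by
      rw [(he _).1, LiftedEdge.flip_proj, (he d).1]
    simp only [f]
    rw [hu.edge_sub hH hp h, LiftedEdge.flip_head, LiftedEdge.flip_tail, hinv (e d).right,
      (e d).right_face, (he d).1]
    ring
  have h2 : ∑ d, (u' (e d).left - u' (e d).right) * (u (e d).head - u (e d).tail) =
      ∑ d, f d + ∑ d, f (T.opp d) := by
    rw [← Finset.sum_add_distrib]
    refine Finset.sum_congr rfl fun d _ => ?_
    rw [hf, (he d).2]
    simp only [f]
    ring
  -- Grouped by faces: `u'` is a common factor, and the differences of `u` around the boundary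
  -- cancel.
  have h3 : ∑ d, f d = 0 := by
    rw [Fintype.sum_prod_type]
    refine Finset.sum_eq_zero fun w _ => ?_
    have h3 : ∀ i, f (w, i) =
        u' (s w) * (u ((s w).vertex (i + 1)) - u ((s w).vertex i)) := by
      intro i
      simp only [f]
      rw [head_eq_of_section (he _), tail_eq_of_section (he _)]
    simp only [h3, Fin.sum_univ_three]
    have h4 : (2 : Fin 3) + 1 = 0 := rfl
    have h5 : (1 : Fin 3) + 1 = 2 := rfl
    rw [h4, h5, zero_add]
    ring
  rw [h2, sum_opp, h3, add_zero]

include hc in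
theorem pairing_eq_zero_of_vertex_invariant [IsDomain R] [CharZero R] (hH : FibreTransitive H)
    (hp : IsCoveringMap p) (hu' : HasPeriods H u')
    (hu : ∀ d ∈ H, ∀ z : T.LiftedVertex p, u (d • z) = u z) : pairing c u u' = 0 := by
  obtain ⟨s, hs⟩ := exists_face_section hc
  have hsec : ∀ d : T.OrientedEdge, ∃ z : T.LiftedVertex p, p z.1 = T.cell d.1 (corner d.2) := by
    intro d
    refine ⟨(s d.1).vertex d.2, ?_⟩
    exact (LiftedFace.proj_vertex _ _).trans (by rw [hs])
  have hver : ∀ x : T.vertices, ∃ z : T.LiftedVertex p, p z.1 = x := by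
    rintro ⟨_, w, i, rfl⟩
    exact hsec (w, i)
  choose z hz using hver
  have hinv : ∀ y, u y = u (z ⟨p y.1, y.2⟩) := by
    intro y
    obtain ⟨d, hd, h⟩ := hH (z ⟨p y.1, y.2⟩).1 y.1 (hz _)
    rw [← hu d hd (z _)]
    exact congrArg u (Subtype.ext h.symm)
  let x : T.OrientedEdge → T.vertices := fun d => ⟨T.cell d.1 (corner d.2), d.1, d.2, rfl⟩
  have hx1 : ∀ d, x ((T.opp d).1, (T.opp d).2 + 1) = x d := by
    intro d
    refine Subtype.ext ?_
    have := T.cell_side d 0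
    rw [side_zero, unitInterval.symm_zero, side_one] at this
    exact this.symm
  have hx2 : ∀ d, x (T.opp d) = x (d.1, d.2 + 1) := by
    intro d
    refine Subtype.ext ?_
    have := T.cell_side d 1
    rw [side_one, unitInterval.symm_one, side_zero] at this
    exact this.symm
  -- All corners at a vertex of `T` are lifted to the one chosen lift of that vertex. The right
  -- shore of an edge leaving it is then the face chosen for the next edge around it, so the
  -- differences of `u'` telescope under `nextEquiv`.
  have hW : ∀ d : T.OrientedEdge, ∃ W : T.LiftedFace p, W.face = d.1 ∧ W.vertex d.2 = z (x d) := by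
    intro d
    obtain ⟨W, hW, h⟩ := exists_liftedFace (T := T) hp (hz (x d))
    exact ⟨W, hW, Subtype.ext h⟩
  choose W hWf hWv using hW
  choose e he using fun d : T.OrientedEdge => exists_liftedEdge hp (W d) d.2
  have hproj : ∀ d, (e d).proj = d := fun d => by rw [(he d).1, hWf]
  have htail : ∀ d, (e d).tail = z (x d) := fun d => by
    rw [LiftedEdge.tail, (he d).2, hproj, hWv]
  have hright : ∀ d, (e d).right = W ((T.opp d).1, (T.opp d).2 + 1) := by
    intro d
    refine liftedFace_ext hp (y := corner ((T.opp d).2 + 1)) ?_ ?_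
    · rw [(e d).right_face, hWf, hproj]
    · have h1 := (e d).right_vertex_add_one
      rw [htail, ← hx1 d, ← hWv, hproj] at h1
      exact congrArg Subtype.val h1
  have hhead : ∀ d, u (e d).head = u (z (x (T.opp d))) := by
    intro d
    rw [hinv]
    congr 2
    refine Subtype.ext ?_
    rw [hx2]
    simp only [LiftedEdge.head, LiftedFace.proj_vertex, (he d).2, hWf, hproj, x]
  have hu'' : HasPeriods H u := fun d hd => ⟨0, fun W => by rw [hu d hd, add_zero]⟩
  refine mul_left_cancel₀ (two_ne_zero (α := R)) ?_
  rw [two_mul_pairing hc hH hp hu'' hu' hproj, mul_zero]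
  let f : T.OrientedEdge → R := fun d => (u' (e d).left - u' (e d).right) * u (z (x d))
  have hf : ∀ d, f (T.opp d) = -((u' (e d).left - u' (e d).right) * u (e d).head) := by
    intro d
    have h : (e (T.opp d)).proj = (e d).flip.proj := by
      rw [hproj, LiftedEdge.flip_proj, hproj]
    simp only [f]
    rw [hu'.face_sub hH hp h, hhead]
    simp only [LiftedEdge.flip]
    ring
  have h2 : ∑ d, (u' (e d).left - u' (e d).right) * (u (e d).head - u (e d).tail) =
      -(∑ d, f d + ∑ d, f (T.opp d)) := by
    rw [← Finset.sum_add_distrib, ← Finset.sum_neg_distrib]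
    refine Finset.sum_congr rfl fun d _ => ?_
    rw [hf, htail]
    simp only [f]
    ring
  have h3 : ∑ d, f d = 0 := by
    have h4 := sum_next fun d => u' (W d) * u (z (x d))
    simp only [f, sub_mul, Finset.sum_sub_distrib]
    rw [← sub_eq_zero.2 h4.symm]
    refine congrArg₂ _ (Finset.sum_congr rfl fun d _ => by rw [(he d).2])
      (Finset.sum_congr rfl fun d _ => by rw [hright, hx1])
  rw [h2, sum_opp, h3, add_zero, neg_zero]

end

end Pairing

/-! ### The symplectic form of the periods -/

section Symplectic

variable {S : Type*} [TopologicalSpace S] {T : Triangulation S}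
  {E : Type*} [TopologicalSpace E] {p : E → S}

open Triangulation

/-- The coboundary of an antisymmetrized function on the oriented edges. -/
def coboundary (T : Triangulation S) : (T.OrientedEdge → ℤ) →+ (T.Face → ℤ) where
  toFun θ w := ∑ i, (θ (w, i) - θ (T.opp (w, i)))
  map_zero' := by ext; simp
  map_add' θ θ' := by
    ext w
    simp only [Pi.add_apply, ← Finset.sum_add_distrib]
    exact Finset.sum_congr rfl fun i _ => by ring

/-- Indicators of adjacent faces differ by the coboundary of their common edge. By connectedness of
the dual graph all faces have one class in the cokernel, so only the total of a 2-cochain can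
obstruct exactness. -/
theorem exists_cochain_of_sum_eq_zero [PreconnectedSpace E] (hp : IsCoveringMap p)
    {s : T.Face → T.LiftedFace p} (hs : ∀ w, (s w).face = w) {a : T.Face → ℤ}
    (ha : ∑ w, a w = 0) :
    ∃ η : T.OrientedEdge → ℤ, (∀ d, η (T.opp d) = -η d) ∧ ∀ w, ∑ i, η (w, i) = a w := by
  classical
  let cl : T.Face → (T.Face → ℤ) ⧸ (coboundary T).range := fun w => (Pi.single w 1 : T.Face → ℤ)
  have hcl : ∀ w w', cl w = cl w' := by
    intro w w'
    have := liftedFace_constant hp (n := fun W => cl W.face) (fun e => ?_) (s w) (s w')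
    · simpa only [hs] using this
    · refine (QuotientAddGroup.eq_iff_sub_mem.2 ⟨Pi.single e.proj 1, ?_⟩)
      funext x
      have h1 : ∑ i, (Pi.single e.proj 1 : T.OrientedEdge → ℤ) (x, i) =
          (Pi.single e.left.face 1 : T.Face → ℤ) x := by
        rw [e.left_face]
        by_cases hx : x = e.proj.1
        · subst hx
          rw [Finset.sum_eq_single e.proj.2]
          · simp
          · intro i _ hi
            exact Pi.single_eq_of_ne (fun h => hi (congrArg Prod.snd h)) _
          · simp
        · rw [Pi.single_eq_of_ne hx]
          exact Finset.sum_eq_zero fun i _ =>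
            Pi.single_eq_of_ne (fun h => hx (congrArg Prod.fst h)) _
      have h2 : ∑ i, (Pi.single e.proj 1 : T.OrientedEdge → ℤ) (T.opp (x, i)) =
          (Pi.single e.right.face 1 : T.Face → ℤ) x := by
        have h3 : ∀ i, (Pi.single e.proj 1 : T.OrientedEdge → ℤ) (T.opp (x, i)) =
            (Pi.single (T.opp e.proj) 1 : T.OrientedEdge → ℤ) (x, i) := by
          intro i
          simp only [Pi.single_apply]
          congr 1
          refine propext ⟨fun h => ?_, fun h => ?_⟩
          · rw [← h, T.opp_opp]
          · rw [h, T.opp_opp]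
        simp only [h3, e.right_face]
        by_cases hx : x = (T.opp e.proj).1
        · subst hx
          rw [Finset.sum_eq_single (T.opp e.proj).2]
          · simp
          · intro i _ hi
            exact Pi.single_eq_of_ne (fun h => hi (congrArg Prod.snd h)) _
          · simp
        · rw [Pi.single_eq_of_ne hx]
          exact Finset.sum_eq_zero fun i _ =>
            Pi.single_eq_of_ne (fun h => hx (congrArg Prod.fst h)) _
      change ∑ i : Fin 3, ((Pi.single e.proj 1 : T.OrientedEdge → ℤ) (x, i) -
        (Pi.single e.proj 1 : T.OrientedEdge → ℤ) (T.opp (x, i))) = _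
      rw [Finset.sum_sub_distrib, h1, h2, Pi.sub_apply]
  have hmem : a ∈ (coboundary T).range := by
    rw [← QuotientAddGroup.eq_zero_iff]
    have h1 : a = ∑ w, a w • (Pi.single w 1 : T.Face → ℤ) := by
      ext x
      simp [Finset.sum_apply, Pi.single_apply]
    rw [h1]
    have h2 : ((∑ w, a w • (Pi.single w 1 : T.Face → ℤ) : T.Face → ℤ) :
        (T.Face → ℤ) ⧸ (coboundary T).range) = ∑ w, a w • cl w := by
      rw [← QuotientAddGroup.mk'_apply, map_sum]
      rfl
    rw [h2]
    rcases isEmpty_or_nonempty T.Face with h | ⟨⟨w₀⟩⟩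
    · simp
    · rw [Finset.sum_congr rfl fun w _ => by rw [hcl w w₀], ← Finset.sum_smul, ha, zero_smul]
  obtain ⟨θ, rfl⟩ := hmem
  refine ⟨fun d => θ d - θ (T.opp d), fun d => ?_, fun w => rfl⟩
  simp only [T.opp_opp]
  ring

variable {H : Subgroup (Deck p)}

theorem HasPeriods.area_eq {u v : T.LiftedVertex p → ℤ} (hu : HasPeriods H u)
    (hv : HasPeriods H v) (hH : FibreTransitive H) (hp : IsCoveringMap p) {W W' : T.LiftedFace p}
    (h : W.face = W'.face) : area u v W = area u v W' := by
  obtain ⟨d, hd, rfl⟩ := hH.exists_smul_face hp h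
  obtain ⟨a, ha⟩ := hu d hd
  obtain ⟨b, hb⟩ := hv d hd
  have h4 : (2 : Fin 3) + 1 = 0 := rfl
  have h5 : (1 : Fin 3) + 1 = 2 := rfl
  simp only [area, smul_vertex, ha, hb, Fin.sum_univ_three, h4, h5, zero_add]
  ring

/-- Two pairs of functions are needed so that the second can cancel the pairing of the first; the
form 2u₁dv₁ + 2u₂dv₂ then becomes closed after subtracting a cochain η pulled back from `T`. -/
theorem sum_symplectic_eq_zero [SimplyConnectedSpace E] (hp : IsCoveringMap p)
    {c : T.Edge → T.LiftedEdge p} (hc : ∀ e, OrientedEdge.edge (c e).proj = e)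
    (hH : FibreTransitive H) {g : ℕ} {dα dβ : Fin g → Deck p}
    (hrel : (List.ofFn fun k => dα k * dβ k * (dα k)⁻¹ * (dβ k)⁻¹).prod = 1)
    {u₁ v₁ u₂ v₂ : T.LiftedVertex p → ℤ}
    (hu₁ : HasPeriods H u₁) (hv₁ : HasPeriods H v₁)
    (hu₂ : HasPeriods H u₂) (hv₂ : HasPeriods H v₂)
    (h : pairing c u₁ (fun W => v₁ (W.vertex 0)) + pairing c u₂ (fun W => v₂ (W.vertex 0)) = 0)
    {A₁ B₁ A₁' B₁' A₂ B₂ A₂' B₂' : Fin g → ℤ}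
    (hA₁ : ∀ k z, u₁ (dα k • z) = u₁ z + A₁ k) (hB₁ : ∀ k z, u₁ (dβ k • z) = u₁ z + B₁ k)
    (hA₁' : ∀ k z, v₁ (dα k • z) = v₁ z + A₁' k) (hB₁' : ∀ k z, v₁ (dβ k • z) = v₁ z + B₁' k)
    (hA₂ : ∀ k z, u₂ (dα k • z) = u₂ z + A₂ k) (hB₂ : ∀ k z, u₂ (dβ k • z) = u₂ z + B₂ k)
    (hA₂' : ∀ k z, v₂ (dα k • z) = v₂ z + A₂' k) (hB₂' : ∀ k z, v₂ (dβ k • z) = v₂ z + B₂' k) :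
    ∑ k, (A₁ k * B₁' k - B₁ k * A₁' k) + ∑ k, (A₂ k * B₂' k - B₂ k * A₂' k) = 0 := by
  obtain ⟨s, hs⟩ := exists_face_section hc
  obtain ⟨η, hη, hηa⟩ := exists_cochain_of_sum_eq_zero hp hs
    (a := fun w => area u₁ v₁ (s w) + area u₂ v₂ (s w)) (by
      rw [Finset.sum_add_distrib, ← two_mul_pairing_eq_sum_area hc hH hp hu₁ hv₁ hs,
        ← two_mul_pairing_eq_sum_area hc hH hp hu₂ hv₂ hs, ← mul_add, h, mul_zero])
  obtain ⟨f, hf⟩ := exists_primitive hp (T := T) (fun W i =>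
    (u₁ (W.vertex i) + u₁ (W.vertex (i + 1))) * (v₁ (W.vertex (i + 1)) - v₁ (W.vertex i)) +
    (u₂ (W.vertex i) + u₂ (W.vertex (i + 1))) * (v₂ (W.vertex (i + 1)) - v₂ (W.vertex i)) -
    η (W.face, i)) (fun W => by
      have h1 := hηa W.face
      rw [hu₁.area_eq hv₁ hH hp (hs W.face), hu₂.area_eq hv₂ hH hp (hs W.face)] at h1
      simp only [area, Fin.sum_univ_three] at h1
      linarith) (fun e => by
      have h1 := hη e.proj
      have h2 : (e.left.face, e.proj.2) = e.proj := by rw [e.left_face]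
      have h3 : (e.right.face, (T.opp e.proj).2) = T.opp e.proj := by rw [e.right_face]
      rw [h2, h3, h1, e.right_vertex, e.right_vertex_add_one, LiftedEdge.head, LiftedEdge.tail]
      ring)
  -- The term η is invariant under `d`, and the differences of `v₁`, `v₂` are too; only the factors
  -- `u₁`, `u₂` change, adding 2a₁dv₁ + 2a₂dv₂ to the differences of `f`.
  have hshift : ∀ (d : Deck p) (a₁ b₁ a₂ b₂ : ℤ), (∀ z, u₁ (d • z) = u₁ z + a₁) →
      (∀ z, v₁ (d • z) = v₁ z + b₁) → (∀ z, u₂ (d • z) = u₂ z + a₂) →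
      (∀ z, v₂ (d • z) = v₂ z + b₂) →
      ∃ κ, ∀ z, f (d • z) = f z + 2 * a₁ * v₁ z + 2 * a₂ * v₂ z + κ := by
    intro d a₁ b₁ a₂ b₂ h₁ h₁' h₂ h₂'
    obtain ⟨s₀⟩ : Nonempty E := inferInstance
    obtain ⟨W₀, -, -⟩ := T.exists_liftedFace_map_eq hp s₀
    refine ⟨f (d • W₀.vertex 0) - f (W₀.vertex 0) - 2 * a₁ * v₁ (W₀.vertex 0) -
      2 * a₂ * v₂ (W₀.vertex 0), fun z => ?_⟩
    have := liftedVertex_constant hp (T := T)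
      (u := fun z => f (d • z) - f z - 2 * a₁ * v₁ z - 2 * a₂ * v₂ z) (fun W i => ?_) z
      (W₀.vertex 0)
    · linarith
    · have e1 := hf W i
      have e2 := hf (d • W) i
      have e3 : (d • W).face = W.face := rfl
      simp only [smul_vertex, h₁, h₁', h₂, h₂', e3] at e2
      linarith
  have hcomm : ∀ k z, f ((dα k * dβ k * (dα k)⁻¹ * (dβ k)⁻¹) • z) =
      f z + 2 * ((A₁ k * B₁' k - B₁ k * A₁' k) + (A₂ k * B₂' k - B₂ k * A₂' k)) := by
    intro k z
    obtain ⟨κ, hκ⟩ := hshift _ _ _ _ _ (hA₁ k) (hA₁' k) (hA₂ k) (hA₂' k)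
    obtain ⟨κ', hκ'⟩ := hshift _ _ _ _ _ (hB₁ k) (hB₁' k) (hB₂ k) (hB₂' k)
    -- From this form of `z` the commutator leads to `dα k • dβ k • y`. Comparing the two orders
    -- cancels the constants κ and κ' and leaves the symplectic term.
    obtain ⟨y, rfl⟩ : ∃ y, z = dβ k • dα k • y :=
      ⟨(dα k)⁻¹ • (dβ k)⁻¹ • z, by rw [smul_inv_smul, smul_inv_smul]⟩
    rw [mul_smul, mul_smul, mul_smul, inv_smul_smul, inv_smul_smul, hκ, hκ', hκ', hκ, hA₁', hA₂',
      hB₁', hB₂']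
    ring
  have hprod : ∀ (l : List (Fin g)) z,
      f ((l.map fun k => dα k * dβ k * (dα k)⁻¹ * (dβ k)⁻¹).prod • z) = f z +
        2 * (l.map fun k => (A₁ k * B₁' k - B₁ k * A₁' k) +
          (A₂ k * B₂' k - B₂ k * A₂' k)).sum := by
    intro l
    induction l with
    | nil => intro z; simp
    | cons k l ih =>
      intro z
      rw [List.map_cons, List.prod_cons, mul_smul, hcomm, ih, List.map_cons, List.sum_cons]
      ring
  obtain ⟨s₀⟩ : Nonempty E := inferInstance
  obtain ⟨W₀, -, -⟩ := T.exists_liftedFace_map_eq hp s₀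
  have h1 := hprod (List.finRange g) (W₀.vertex 0)
  rw [← List.ofFn_eq_map, ← List.ofFn_eq_map, hrel, one_smul, List.sum_ofFn,
    Finset.sum_add_distrib] at h1
  linarith

end Symplectic

/-! ### Existence of functions with given periods -/

section Existence

variable {S : Type*} [TopologicalSpace S] {T : Triangulation S}
  {E : Type*} [TopologicalSpace E] {p : E → S}

open Triangulation

theorem finite_vertices (T : Triangulation S) : T.vertices.Finite := by
  refine (Set.finite_range fun d : T.OrientedEdge => T.cell d.1 (corner d.2)).subset ?_
  rintro _ ⟨w, i, rfl⟩
  exact ⟨(w, i), rfl⟩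

/-- The rational functions on the lifted vertices changed by constants by each `d j`. -/
def periodicFunctions (T : Triangulation S) {ι : Type*} (d : ι → Deck p) :
    Submodule ℚ (T.LiftedVertex p → ℚ) where
  carrier := {u | ∀ j z z', u (d j • z) - u z = u (d j • z') - u z'}
  add_mem' {u v} hu hv j z z' := by
    simp only [Pi.add_apply]
    linarith [hu j z z', hv j z z']
  zero_mem' j z z' := by simp
  smul_mem' a u hu j z z' := by
    simp only [Pi.smul_apply, smul_eq_mul, ← mul_sub, hu j z z']

open Classical in
/-- The sign of an oriented edge with respect to the orientation of the edges given by `c`. -/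
def edgeSign (c : T.Edge → T.LiftedEdge p) (d : T.OrientedEdge) : ℤ :=
  if (c d.edge).proj = d then 1 else -1

section

/-! ### Dimension estimates for rational cochains -/

variable {c : T.Edge → T.LiftedEdge p} (hc : ∀ e, OrientedEdge.edge (c e).proj = e)

theorem edge_opp (d : T.OrientedEdge) : OrientedEdge.edge (T.opp d) = d.edge :=
  edge_eq_iff.2 (.inr (T.opp_opp d).symm)

include hc in
theorem edgeSign_opp (d : T.OrientedEdge) : edgeSign c (T.opp d) = -edgeSign c d := by
  rw [edgeSign, edgeSign, edge_opp]
  rcases edge_eq_iff.1 (hc d.edge) with h | h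
  · rw [if_neg (fun h' => T.opp_ne d (h'.symm.trans h.symm)), if_pos h.symm]
  · have h' : (c d.edge).proj = T.opp d :=
      ((congrArg T.opp h).trans (T.opp_opp _)).symm
    rw [if_pos h', if_neg (fun h'' => T.opp_ne d (h'.symm.trans h''))]
    rfl

include hc in
theorem edgeSign_proj (e : T.Edge) : edgeSign c (c e).proj = 1 := by
  rw [edgeSign, hc, if_pos rfl]

/-- The coboundary of a rational cochain. -/
def rationalCoboundary (c : T.Edge → T.LiftedEdge p) : (T.Edge → ℚ) →ₗ[ℚ] (T.Face → ℚ) where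
  toFun x w := ∑ i, edgeSign c (w, i) * x (OrientedEdge.edge (w, i))
  map_add' x y := by
    ext w
    simp only [Pi.add_apply, mul_add, Finset.sum_add_distrib]
  map_smul' a x := by
    ext w
    simp only [Pi.smul_apply, smul_eq_mul, Finset.mul_sum, RingHom.id_apply]
    exact Finset.sum_congr rfl fun i _ => by ring

include hc in
theorem sum_rationalCoboundary (x : T.Edge → ℚ) : ∑ w, rationalCoboundary c x w = 0 := by
  have h1 : ∑ w, rationalCoboundary c x w =
      ∑ d : T.OrientedEdge, edgeSign c d * x (OrientedEdge.edge d) :=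
    (Fintype.sum_prod_type fun d : T.OrientedEdge =>
      (edgeSign c d : ℚ) * x (OrientedEdge.edge d)).symm
  have h2 := sum_opp fun d : T.OrientedEdge => (edgeSign c d : ℚ) * x (OrientedEdge.edge d)
  simp only [edgeSign_opp hc, edge_opp, Int.cast_neg, neg_mul, Finset.sum_neg_distrib] at h2
  linarith

include hc in
-- Coboundaries have total zero, because an edge occurs with opposite signs on its two sides; so the
-- rank is at most the number of faces minus one.
theorem card_le_finrank_ker_rationalCoboundary [Nonempty T.Face] :
    Fintype.card T.Edge + 1 ≤
      Module.finrank ℚ (LinearMap.ker (rationalCoboundary c)) + Fintype.card T.Face := by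
  let total : (T.Face → ℚ) →ₗ[ℚ] ℚ := ∑ w, LinearMap.proj w
  have htotal : ∀ y, total y = ∑ w, y w := fun y => by simp [total]
  have hsurj : LinearMap.range total = ⊤ := by
    classical
    obtain ⟨w⟩ := ‹Nonempty T.Face›
    refine LinearMap.range_eq_top.2 fun a => ⟨Pi.single w a, ?_⟩
    rw [htotal, Finset.sum_pi_single']
    simp
  have hle : LinearMap.range (rationalCoboundary c) ≤ LinearMap.ker total := by
    rintro _ ⟨x, rfl⟩
    rw [LinearMap.mem_ker, htotal, sum_rationalCoboundary hc]
  have h1 := total.finrank_range_add_finrank_ker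
  have h2 := (rationalCoboundary c).finrank_range_add_finrank_ker
  have h3 := Submodule.finrank_mono hle
  rw [hsurj, finrank_top, Module.finrank_self, Module.finrank_fintype_fun_eq_card] at h1
  rw [Module.finrank_fintype_fun_eq_card] at h2
  omega

/-- The differences of a function along the edges. -/
def edgeDifference (c : T.Edge → T.LiftedEdge p) : (T.LiftedVertex p → ℚ) →ₗ[ℚ] (T.Edge → ℚ) where
  toFun u e := u (c e).head - u (c e).tail
  map_add' u v := by
    ext e
    simp only [Pi.add_apply]
    ring
  map_smul' a u := by
    ext e
    simp only [Pi.smul_apply, smul_eq_mul, RingHom.id_apply]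
    ring

theorem exists_shift_of_vertex_sub [PreconnectedSpace E] (hp : IsCoveringMap p) {R : Type*}
    [CommRing R] {u : T.LiftedVertex p → R} {ξ : T.Face → Fin 3 → R}
    (h : ∀ (W : T.LiftedFace p) i, u (W.vertex (i + 1)) - u (W.vertex i) = ξ W.face i)
    (d : Deck p) (z z' : T.LiftedVertex p) : u (d • z) - u z = u (d • z') - u z' := by
  refine liftedVertex_constant hp (u := fun z => u (d • z) - u z) (fun W i => ?_) z z'
  have h1 := h W i
  have h2 := h (d • W) i
  simp only [smul_vertex] at h2
  have h3 : (d • W).face = W.face := rfl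
  rw [h3, ← h1] at h2
  linear_combination h2

include hc in
theorem ker_rationalCoboundary_le [SimplyConnectedSpace E] (hp : IsCoveringMap p) {ι : Type*}
    (d : ι → Deck p) :
    LinearMap.ker (rationalCoboundary c) ≤
      (periodicFunctions T d).map (edgeDifference c) := by
  intro x hx
  -- Denominators are cleared so that the integral primitive can be used; the primitive is divided
  -- by `N` afterwards.
  obtain ⟨N, hN⟩ := IsLocalization.exist_integer_multiples_of_finite (nonZeroDivisors ℤ) x
  choose y hy using hN
  have hN0 : ((N : ℤ) : ℚ) ≠ 0 := Int.cast_ne_zero.2 (nonZeroDivisors.coe_ne_zero N)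
  have hy' : ∀ e, (y e : ℚ) = (N : ℤ) * x e := fun e => by
    have := hy e
    simpa [Algebra.smul_def] using this
  let ξ : T.Face → Fin 3 → ℤ := fun w i => edgeSign c (w, i) * y (OrientedEdge.edge (w, i))
  obtain ⟨f, hf⟩ := exists_primitive hp (T := T) (fun W i => ξ W.face i) (fun W => by
      have h1 := congrFun hx W.face
      change ∑ i : Fin 3, (edgeSign c (W.face, i) : ℚ) * x (OrientedEdge.edge (W.face, i)) = 0 at h1
      rw [Fin.sum_univ_three] at h1
      have h2 : ((ξ W.face 0 + ξ W.face 1 + ξ W.face 2 : ℤ) : ℚ) = 0 := by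
        simp only [ξ, Int.cast_add, Int.cast_mul, hy']
        linear_combination ((N : ℤ) : ℚ) * h1
      exact_mod_cast h2) (fun e => by
      have h2 : (e.left.face, e.proj.2) = e.proj := by rw [e.left_face]
      have h3 : (e.right.face, (T.opp e.proj).2) = T.opp e.proj := by rw [e.right_face]
      simp only [ξ, h2, h3, edgeSign_opp hc, edge_opp]
      ring)
  refine ⟨fun z => f z / (N : ℤ), ?_, ?_⟩
  · intro j z z'
    have := exists_shift_of_vertex_sub hp hf (d j) z z'
    have h2 : (f (d j • z) - f z : ℚ) = f (d j • z') - f z' := by exact_mod_cast this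
    simp only [← sub_div, h2]
  · ext e
    have h1 := hf (c e).left (c e).proj.2
    have h2 : ((c e).left.face, (c e).proj.2) = (c e).proj := by rw [(c e).left_face]
    simp only [ξ, h2, edgeSign_proj hc, hc, one_mul] at h1
    change (f (c e).head : ℚ) / (N : ℤ) - f (c e).tail / (N : ℤ) = x e
    rw [← sub_div, div_eq_iff hN0, mul_comm, ← hy', ← h1]
    push_cast
    rfl

end

theorem exists_hasPeriods [SimplyConnectedSpace E] (hp : IsCoveringMap p)
    {c : T.Edge → T.LiftedEdge p} (hc : ∀ e, OrientedEdge.edge (c e).proj = e)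
    {g : ℕ} (hT : T.HasGenus g) {d : Fin g ⊕ Fin g → Deck p}
    (hH : FibreTransitive (Subgroup.closure (Set.range d))) (P : Fin g ⊕ Fin g → ℤ) :
    ∃ u : T.LiftedVertex p → ℤ, ∀ j z, u (d j • z) = u z + P j := by
  obtain ⟨x₀⟩ : Nonempty E := inferInstance
  obtain ⟨W₀, -, -⟩ := T.exists_liftedFace_map_eq hp x₀
  have : Nonempty T.Face := ⟨W₀.face⟩
  obtain ⟨s, hs⟩ := exists_face_section hc
  have hver : ∀ x : T.vertices, ∃ z : T.LiftedVertex p, p z.1 = x := by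
    rintro ⟨_, w, i, rfl⟩
    exact ⟨(s w).vertex i, ((s w).proj_vertex i).trans (by rw [hs])⟩
  choose z hz using hver
  have := (finite_vertices T).to_subtype
  have := Fintype.ofFinite T.vertices
  let M := periodicFunctions T d
  let per : M →ₗ[ℚ] (Fin g ⊕ Fin g → ℚ) :=
    { toFun := fun u j => u.1 (d j • W₀.vertex 0) - u.1 (W₀.vertex 0)
      map_add' := fun u v => by
        ext j
        simp only [Submodule.coe_add, Pi.add_apply]
        ring
      map_smul' := fun a u => by
        ext j
        simp only [Submodule.coe_smul, Pi.smul_apply, smul_eq_mul, RingHom.id_apply]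
        ring }
  let res : M →ₗ[ℚ] (T.vertices → ℚ) := (LinearMap.funLeft ℚ ℚ z).comp M.subtype
  -- With zero periods, `u` is invariant on fibres and is determined by one value over each vertex
  -- of `T`.
  have hker : ∀ u : M, per u = 0 → res u = 0 → u = 0 := by
    intro u h1 h2
    have hinv : ∀ t ∈ Subgroup.closure (Set.range d), ∀ y, u.1 (t • y) = u.1 y := by
      refine invariant_closure ?_
      rintro _ ⟨j, rfl⟩ y
      have h3 := u.2 j y (W₀.vertex 0)
      have h4 : u.1 (d j • W₀.vertex 0) - u.1 (W₀.vertex 0) = 0 := congrFun h1 j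
      rw [h4] at h3
      linarith
    refine Subtype.ext (funext fun y => ?_)
    obtain ⟨t, ht, h⟩ := hH (z ⟨p y.1, y.2⟩).1 y.1 (hz _)
    have h3 := hinv t ht (z ⟨p y.1, y.2⟩)
    have h4 : t • z ⟨p y.1, y.2⟩ = y := Subtype.ext h
    rw [h4] at h3
    rw [h3]
    exact congrFun h2 _
  have : FiniteDimensional ℚ M := by
    refine Module.Finite.of_injective (per.prod res) ?_
    rw [← LinearMap.ker_eq_bot, LinearMap.ker_eq_bot']
    intro u hu
    exact hker u (congrArg Prod.fst hu) (congrArg Prod.snd hu)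
  have h1 : Module.finrank ℚ (LinearMap.ker per) ≤ Fintype.card T.vertices := by
    rw [← Module.finrank_fintype_fun_eq_card (R := ℚ)]
    refine LinearMap.finrank_le_finrank_of_injective (f := res.domRestrict (LinearMap.ker per))
      ((injective_iff_map_eq_zero _).2 fun u hu => ?_)
    exact Subtype.ext (hker u.1 u.2 hu)
  let D : M →ₗ[ℚ] (T.Edge → ℚ) := (edgeDifference c).comp M.subtype
  have h2 : Module.finrank ℚ (LinearMap.ker (rationalCoboundary c)) ≤
      Module.finrank ℚ (LinearMap.range D) := by
    refine Submodule.finrank_mono ?_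
    rw [LinearMap.range_comp, Submodule.range_subtype]
    exact ker_rationalCoboundary_le hc hp d
  -- The constant functions lie in this kernel. With V, E, F the numbers of vertices, edges and
  -- faces, dim M ≥ (E − F + 1) + 1, so the rank of `per` is at least E − F + 2 − V = 2g.
  have h3 : 0 < Module.finrank ℚ (LinearMap.ker D) := by
    let u₁ : M := ⟨fun _ => 1, fun _ _ _ => rfl⟩
    have hu₁ : u₁ ∈ LinearMap.ker D := by
      ext e
      exact sub_self _
    have : Nontrivial (LinearMap.ker D) := by
      refine ⟨⟨u₁, hu₁⟩, 0, fun h => ?_⟩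
      have := congrFun (congrArg (fun u : LinearMap.ker D => u.1.1) h) (W₀.vertex 0)
      exact one_ne_zero this
    exact Module.finrank_pos (R := ℚ) (M := LinearMap.ker D)
  have h4 := card_le_finrank_ker_rationalCoboundary hc
  have h5 := D.finrank_range_add_finrank_ker
  have h6 := per.finrank_range_add_finrank_ker
  have h7 : LinearMap.range per = ⊤ := by
    refine Submodule.eq_top_of_finrank_eq (le_antisymm (Submodule.finrank_le _) ?_)
    rw [Module.finrank_fintype_fun_eq_card, Fintype.card_sum, Fintype.card_fin]
    have h8 := hT
    rw [HasGenus, ← Nat.card_coe_set_eq, Nat.card_eq_fintype_card, Nat.card_eq_fintype_card,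
      Nat.card_eq_fintype_card] at h8
    omega
  obtain ⟨u, hu⟩ := LinearMap.range_eq_top.1 h7 fun j => (P j : ℚ)
  -- The floor commutes with adding the integer periods, so it makes the values integral without
  -- changing them.
  refine ⟨fun y => ⌊u.1 y⌋, fun j y => ?_⟩
  have h8 := u.2 j y (W₀.vertex 0)
  have h9 : u.1 (d j • W₀.vertex 0) - u.1 (W₀.vertex 0) = P j := congrFun hu j
  rw [← Int.floor_add_intCast, ← h9, ← h8]
  ring_nf

end Existence

/-! ### The bilinear identity -/

section Identity

variable {S : Type*} [TopologicalSpace S] {T : Triangulation S}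
  {E : Type*} [TopologicalSpace E] {p : E → S}

open Triangulation

theorem IsEdgePath.sum_sub {R : Type*} [AddCommGroup R] (u : T.LiftedVertex p → R) :
    ∀ {a : List (T.LiftedEdge p)} {z z' : T.LiftedVertex p}, IsEdgePath z a z' →
      (a.map fun e => u e.head - u e.tail).sum = u z' - u z
  | [], z, z', h => by
    have h : z = z' := h
    simp [h]
  | e :: a, z, z', h => by
    obtain ⟨rfl, h⟩ := h
    rw [List.map_cons, List.sum_cons, IsEdgePath.sum_sub u h]
    abel

theorem IsFacePath.sum_sub {R : Type*} [AddCommGroup R] (u' : T.LiftedFace p → R) :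
    ∀ {b : List (T.LiftedEdge p)} {w w' : T.LiftedFace p}, IsFacePath w b w' →
      (b.map fun f => u' f.left - u' f.right).sum = u' w' - u' w
  | [], w, w', h => by
    have h : w = w' := h
    simp [h]
  | f :: b, w, w', h => by
    obtain ⟨rfl, h⟩ := h
    rw [List.map_cons, List.sum_cons, IsFacePath.sum_sub u' h]
    abel

open Classical in
/-- The cochain whose value on an oriented edge is the number of its signed coincidences with
`x`. -/
def edgeCochain (x d : T.OrientedEdge) : ℤ :=
  if x = d then 1 else if x = T.opp d then -1 else 0

theorem edgeCochain_opp (x d : T.OrientedEdge) : edgeCochain x (T.opp d) = -edgeCochain x d := by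
  have h0 : T.opp (T.opp d) = d := T.opp_opp d
  have := T.opp_ne d
  unfold edgeCochain
  rw [h0]
  by_cases h : x = d
  · subst h
    rw [if_neg this.symm, if_pos rfl, if_pos rfl]
  · by_cases h' : x = T.opp d
    · rw [if_pos h', if_neg h, if_pos h', neg_neg]
    · rw [if_neg h', if_neg h, if_neg h, if_neg h', neg_zero]

open Classical in
theorem sum_edgeCochain (x : T.OrientedEdge) (w : T.Face) :
    ∑ i, edgeCochain x (w, i) =
      (if x.1 = w then 1 else 0) - (if (T.opp x).1 = w then 1 else 0) := by
  have h1 : ∀ (y : T.OrientedEdge), ∑ i, (if y = (w, i) then (1 : ℤ) else 0) =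
      if y.1 = w then 1 else 0 := by
    rintro ⟨y, j⟩
    by_cases h : y = w
    · subst h
      simp
    · simp [h]
  rw [← h1, ← h1, ← Finset.sum_sub_distrib]
  refine Finset.sum_congr rfl fun i _ => ?_
  have h2 : x = T.opp (w, i) ↔ T.opp x = (w, i) :=
    ⟨fun h => by rw [h, T.opp_opp], fun h => by rw [← h, T.opp_opp]⟩
  have h3 : x = (w, i) → ¬ T.opp x = (w, i) := fun h h' => T.opp_ne x (h'.trans h.symm)
  simp only [edgeCochain, h2]
  by_cases h : x = (w, i)
  · rw [if_pos h, if_pos h, if_neg (h3 h), sub_zero]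
  · rw [if_neg h, if_neg h]
    split_ifs <;> simp

/-! ### Face paths, dual functions and the normalization of the pairing -/

variable {H : Subgroup (Deck p)} {c : T.Edge → T.LiftedEdge p}
  (hc : ∀ e, OrientedEdge.edge (c e).proj = e)

include hc in
theorem sum_face_sub_mul_edgeCochain (hH : FibreTransitive H) (hp : IsCoveringMap p)
    {u' : T.LiftedFace p → ℤ} (hu' : HasPeriods H u') (f : T.LiftedEdge p) :
    ∑ e, (u' (c e).left - u' (c e).right) * edgeCochain f.proj (c e).proj =
      u' f.left - u' f.right := by
  rw [Finset.sum_eq_single (OrientedEdge.edge f.proj)]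
  · rcases edge_eq_iff.1 (hc (OrientedEdge.edge f.proj)) with h | h
    · rw [hu'.face_sub hH hp h.symm, edgeCochain, if_pos h, mul_one]
    · have h1 : (c (OrientedEdge.edge f.proj)).proj = f.flip.proj := by
        rw [LiftedEdge.flip_proj]
        exact ((congrArg T.opp h).trans (T.opp_opp _)).symm
      have h2 : (c (OrientedEdge.edge f.proj)).proj = T.opp f.proj := h1
      rw [hu'.face_sub hH hp h1, h2, edgeCochain_opp, edgeCochain, if_pos rfl]
      simp only [LiftedEdge.flip]
      ring
  · intro e _ he
    rw [edgeCochain, if_neg, if_neg, mul_zero]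
    · intro h
      exact he (by rw [← hc e, h, edge_opp])
    · intro h
      exact he (by rw [← hc e, h])
  · simp

include hc in
theorem pairing_eq_sum_of_cochain (hH : FibreTransitive H) (hp : IsCoveringMap p)
    {u : T.LiftedVertex p → ℤ} {u' : T.LiftedFace p → ℤ} (hu' : HasPeriods H u')
    {b : List (T.LiftedEdge p)} (hu : ∀ e : T.LiftedEdge p,
      u e.head - u e.tail = (b.map fun f => edgeCochain f.proj e.proj).sum) :
    pairing c u u' = (b.map fun f => u' f.left - u' f.right).sum := by
  simp only [pairing, hu]
  clear hu
  induction b with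
  | nil => simp
  | cons f b ih =>
    simp only [List.map_cons, List.sum_cons, mul_add, Finset.sum_add_distrib, ih,
      sum_face_sub_mul_edgeCochain hc hH hp hu' f]

/-- A function on the lifted vertices whose differences are the intersection numbers with a
closed path through faces. -/
theorem exists_dual_of_facePath [SimplyConnectedSpace E] (hp : IsCoveringMap p) {d : Deck p}
    {w : T.LiftedFace p} {b : List (T.LiftedEdge p)} (hb : IsFacePath w b (d.onFace w)) :
    ∃ u : T.LiftedVertex p → ℤ, ∀ (W : T.LiftedFace p) i, u (W.vertex (i + 1)) - u (W.vertex i) =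
      (b.map fun f => edgeCochain f.proj (W.face, i)).sum := by
  classical
  refine exists_primitive hp _ (fun W => ?_) (fun e => ?_)
  · rw [← Fin.sum_univ_three fun i => (b.map fun f => edgeCochain f.proj (W.face, i)).sum]
    -- The test function counts entries into the lifts of one face minus exits; the total is zero
    -- because both ends of the path lie over the same face of `T`.
    have h1 := hb.sum_sub fun V : T.LiftedFace p => if V.face = W.face then (1 : ℤ) else 0
    have h2 : (d.onFace w).face = w.face := rfl
    rw [h2, sub_self] at h1
    rw [← h1]
    clear h1 hb
    induction b with
    | nil => simp
    | cons f b ih =>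
      simp only [List.map_cons, List.sum_cons, Finset.sum_add_distrib, ih, sum_edgeCochain,
        f.left_face, f.right_face]
  · have h2 : (e.left.face, e.proj.2) = e.proj := by rw [e.left_face]
    have h3 : (e.right.face, (T.opp e.proj).2) = T.opp e.proj := by rw [e.right_face]
    rw [h2, h3]
    clear hb
    induction b with
    | nil => simp
    | cons f b ih =>
      rw [List.map_cons, List.sum_cons, List.map_cons, List.sum_cons, ih, edgeCochain_opp]
      ring

/-- The pairing as a bilinear map. -/
def pairingBilin {R : Type*} [CommRing R] (c : T.Edge → T.LiftedEdge p) :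
    (T.LiftedVertex p → R) →ₗ[R] (T.LiftedFace p → R) →ₗ[R] R :=
  LinearMap.mk₂ R (pairing c)
    (fun u v u' => by
      simp only [pairing, Pi.add_apply, ← Finset.sum_add_distrib]
      exact Finset.sum_congr rfl fun e _ => by ring)
    (fun a u u' => by
      simp only [pairing, Pi.smul_apply, smul_eq_mul, Finset.mul_sum]
      exact Finset.sum_congr rfl fun e _ => by ring)
    (fun u u' v' => by
      simp only [pairing, Pi.add_apply, ← Finset.sum_add_distrib]
      exact Finset.sum_congr rfl fun e _ => by ring)
    (fun a u u' => by
      simp only [pairing, Pi.smul_apply, smul_eq_mul, Finset.mul_sum]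
      exact Finset.sum_congr rfl fun e _ => by ring)

theorem pairingBilin_apply {R : Type*} [CommRing R] (u : T.LiftedVertex p → R)
    (u' : T.LiftedFace p → R) : pairingBilin c u u' = pairing c u u' := rfl

/-- The standard symplectic form. -/
def symplecticForm {R : Type*} [CommRing R] {g : ℕ} (P P' : Fin g ⊕ Fin g → R) : R :=
  ∑ k, (P (.inl k) * P' (.inr k) - P (.inr k) * P' (.inl k))

theorem sum_mul_symplecticForm_single {R : Type*} [CommRing R] {g : ℕ}
    (P P' : Fin g ⊕ Fin g → R) :
    ∑ i, P i * ∑ j, P' j * symplecticForm (Pi.single i 1) (Pi.single j 1) =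
      symplecticForm P P' := by
  simp [symplecticForm, Fintype.sum_sum_type, Pi.single_apply, sub_eq_add_neg,
    Finset.sum_add_distrib]

/-- With m and l the pairings of the reference pair and of (u, v), the pairs (m u, v) and (−l U, U')
have total pairing ml − lm = 0. Since the reference pair has symplectic form 1,
`sum_symplectic_eq_zero` reads m ω(P, P') − l = 0. -/
theorem pairing_eq_mul_symplecticForm [SimplyConnectedSpace E] (hp : IsCoveringMap p)
    {g : ℕ} {d : Fin g ⊕ Fin g → Deck p} (hc : ∀ e, OrientedEdge.edge (c e).proj = e)
    (hH : FibreTransitive (Subgroup.closure (Set.range d)))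
    (hrel : (List.ofFn fun k =>
      d (.inl k) * d (.inr k) * (d (.inl k))⁻¹ * (d (.inr k))⁻¹).prod = 1)
    {U : Fin g ⊕ Fin g → T.LiftedVertex p → ℤ}
    (hU : ∀ i j z, U i (d j • z) = U i z + (Pi.single i 1 : Fin g ⊕ Fin g → ℤ) j) (k : Fin g)
    {u v : T.LiftedVertex p → ℤ} {P P' : Fin g ⊕ Fin g → ℤ}
    (hu : ∀ j z, u (d j • z) = u z + P j) (hv : ∀ j z, v (d j • z) = v z + P' j) :
    pairing c u (fun W => v (W.vertex 0)) =
      pairing c (U (.inl k)) (fun W => U (.inr k) (W.vertex 0)) * symplecticForm P P' := by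
  have hper : ∀ {f : T.LiftedVertex p → ℤ} {Q : Fin g ⊕ Fin g → ℤ},
      (∀ j z, f (d j • z) = f z + Q j) → HasPeriods (Subgroup.closure (Set.range d)) f := by
    intro f Q h
    refine hasPeriods_closure ?_
    rintro _ ⟨j, rfl⟩
    exact ⟨Q j, h j⟩
  set m := pairing c (U (.inl k)) (fun W => U (.inr k) (W.vertex 0)) with hm
  set l := pairing c u (fun W => v (W.vertex 0)) with hl
  have h1 : ∀ j z, (m • u) (d j • z) = (m • u) z + m * P j := fun j z => by
    simp only [Pi.smul_apply, smul_eq_mul, hu]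
    ring
  have h2 : ∀ j z, ((-l) • U (.inl k)) (d j • z) = ((-l) • U (.inl k)) z +
      (-l) * (Pi.single (.inl k) 1 : Fin g ⊕ Fin g → ℤ) j := fun j z => by
    simp only [Pi.smul_apply, smul_eq_mul, hU]
    ring
  have h := sum_symplectic_eq_zero hp hc hH hrel (hper h1) (hper hv) (hper h2) (hper (hU (.inr k)))
    (by
      rw [← pairingBilin_apply, ← pairingBilin_apply, map_smul, map_smul, LinearMap.smul_apply,
        LinearMap.smul_apply, pairingBilin_apply, pairingBilin_apply, ← hm, ← hl, smul_eq_mul,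
        smul_eq_mul]
      ring)
    (fun k z => h1 (.inl k) z) (fun k z => h1 (.inr k) z)
    (fun k z => hv (.inl k) z) (fun k z => hv (.inr k) z)
    (fun k z => h2 (.inl k) z) (fun k z => h2 (.inr k) z)
    (fun j z => hU (.inr k) (.inl j) z) (fun j z => hU (.inr k) (.inr j) z)
  have h3 : ∑ k, (m * P (.inl k) * P' (.inr k) - m * P (.inr k) * P' (.inl k)) =
      m * symplecticForm P P' := by
    rw [symplecticForm, Finset.mul_sum]
    exact Finset.sum_congr rfl fun k _ => by ring
  rw [h3] at h
  simp [Pi.single_apply] at h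
  linarith

theorem pairing_eq_symplecticForm [SimplyConnectedSpace E] (hp : IsCoveringMap p)
    {g : ℕ} {d : Fin g ⊕ Fin g → Deck p} (hc : ∀ e, OrientedEdge.edge (c e).proj = e)
    (hT : T.HasGenus g) (hH : FibreTransitive (Subgroup.closure (Set.range d)))
    (hrel : (List.ofFn fun k =>
      d (.inl k) * d (.inr k) * (d (.inl k))⁻¹ * (d (.inr k))⁻¹).prod = 1)
    {k : Fin g} {n : ℤ} (hk : IsIntersectionNumber T (d (.inl k)) (d (.inr k)) n) (hn : 0 < n)
    {u : T.LiftedVertex p → ℝ} {u' : T.LiftedFace p → ℝ} {P P' : Fin g ⊕ Fin g → ℝ}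
    (hu : ∀ j z, u (d j • z) = u z + P j) (hu' : ∀ j W, u' (d j • W) = u' W + P' j) :
    pairing c u u' = symplecticForm P P' := by
  choose U hU using fun i : Fin g ⊕ Fin g =>
    exists_hasPeriods hp hc hT hH (Pi.single i 1 : Fin g ⊕ Fin g → ℤ)
  have hUper : ∀ i, HasPeriods (Subgroup.closure (Set.range d)) (U i) := by
    intro i
    refine hasPeriods_closure ?_
    rintro _ ⟨j, rfl⟩
    exact ⟨_, hU i j⟩
  have hmul := fun {u v} {P P' : Fin g ⊕ Fin g → ℤ} =>
    pairing_eq_mul_symplecticForm hp hc hH hrel hU k (u := u) (v := v) (P := P) (P' := P')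
  -- The dual of the second loop detects the orientation.
  have hone : pairing c (U (.inl k)) (fun W => U (.inr k) (W.vertex 0)) = 1 := by
    obtain ⟨z, a, w, b, ha, hb, hnab⟩ := hk
    obtain ⟨f, hf⟩ := exists_dual_of_facePath hp hb
    have hfe : ∀ e : T.LiftedEdge p, f e.head - f e.tail =
        (b.map fun f => edgeCochain f.proj e.proj).sum := by
      intro e
      have h2 : (e.left.face, e.proj.2) = e.proj := by rw [e.left_face]
      rw [LiftedEdge.head, LiftedEdge.tail, hf, h2]
    have h1 : f (d (.inl k) • z) - f z = n := by
      have := ha.sum_sub f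
      simp only [hfe] at this
      rw [hnab]
      exact this.symm
    -- The pairing of `f` with the reference function is evaluated twice: along the face path it
    -- telescopes to the period 1, while proportionality to ω gives m n. Only the period of `f`
    -- under `d (.inl k)` matters, as the reference function has a single nonzero period.
    have h2 := pairing_eq_sum_of_cochain hc hH hp (hUper (.inr k)).comp_vertex hfe
    rw [hb.sum_sub fun W => U (.inr k) (W.vertex 0)] at h2
    have h3 : U (.inr k) ((d (.inr k) • w).vertex 0) = U (.inr k) (w.vertex 0) + 1 := by
      rw [smul_vertex, hU, Pi.single_eq_same]
    have h4 := hmul (u := f) (P := fun j => f (d j • z) - f z) (fun j y => by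
      rw [exists_shift_of_vertex_sub hp
        (ξ := fun w i => (b.map fun f => edgeCochain f.proj (w, i)).sum) hf (d j) z y]
      ring) (hU (.inr k))
    have h5 : symplecticForm (fun j => f (d j • z) - f z)
        (Pi.single (.inr k) 1 : Fin g ⊕ Fin g → ℤ) = n := by
      simp [symplecticForm, Pi.single_apply, h1]
    rw [h2, h5] at h4
    change U (.inr k) ((d (.inr k) • w).vertex 0) - _ = _ at h4
    rw [h3, add_sub_cancel_left] at h4
    have h6 : n = 1 := Int.eq_one_of_dvd_one hn.le ⟨_, h4.trans (mul_comm _ _)⟩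
    rw [h6, mul_one] at h4
    exact h4.symm
  have hbasis : ∀ i j, pairing c (fun z => (U i z : ℝ)) (fun W => (U j (W.vertex 0) : ℝ)) =
      symplecticForm (Pi.single i 1) (Pi.single j 1) := by
    intro i j
    have h1 := hmul (hU i) (hU j)
    rw [hone, one_mul] at h1
    have h2 := congrArg (Int.cast : ℤ → ℝ) h1
    simp only [pairing, symplecticForm, Pi.single_apply] at h2 ⊢
    push_cast at h2
    exact h2
  have hUR : ∀ i j z, ((U i (d j • z) : ℤ) : ℝ) =
      U i z + (Pi.single i 1 : Fin g ⊕ Fin g → ℝ) j := by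
    intro i j z
    rw [hU]
    simp only [Pi.single_apply]
    push_cast
    rfl
  have hURper : ∀ i, HasPeriods (Subgroup.closure (Set.range d)) fun z => (U i z : ℝ) := by
    intro i
    refine hasPeriods_closure ?_
    rintro _ ⟨j, rfl⟩
    exact ⟨_, hUR i j⟩
  have hu'per : HasPeriods (Subgroup.closure (Set.range d)) u' := by
    refine hasPeriods_closure ?_
    rintro _ ⟨j, rfl⟩
    exact ⟨_, hu' j⟩
  -- Subtracting the combination of basis functions with the same periods leaves an invariant
  -- function, whose pairing is zero.
  have hleft : pairing c u u' = ∑ i, P i * pairing c (fun z => (U i z : ℝ)) u' := by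
    have h0 := pairing_eq_zero_of_vertex_invariant hc hH hp hu'per
      (u := u - ∑ i, P i • fun z => (U i z : ℝ)) (invariant_closure (by
        rintro _ ⟨j, rfl⟩ z
        simp only [Pi.sub_apply, Finset.sum_apply, Pi.smul_apply, smul_eq_mul, hu, hUR, mul_add,
          Finset.sum_add_distrib]
        simp [Pi.single_apply]))
    rw [← pairingBilin_apply, map_sub, map_sum, LinearMap.sub_apply, LinearMap.sum_apply,
      sub_eq_zero] at h0
    simpa only [map_smul, LinearMap.smul_apply, smul_eq_mul, pairingBilin_apply] using h0
  have hright : ∀ i, pairing c (fun z => (U i z : ℝ)) u' =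
      ∑ j, P' j * pairing c (fun z => (U i z : ℝ)) (fun W => (U j (W.vertex 0) : ℝ)) := by
    intro i
    have h0 := pairing_eq_zero_of_face_invariant hc hH hp (hURper i)
      (u' := u' - ∑ j, P' j • fun W : T.LiftedFace p => (U j (W.vertex 0) : ℝ))
      (invariant_closure (by
        rintro _ ⟨j, rfl⟩ z
        simp only [Pi.sub_apply, Finset.sum_apply, Pi.smul_apply, smul_eq_mul, hu', smul_vertex,
          hUR, mul_add, Finset.sum_add_distrib]
        simp [Pi.single_apply]))
    rw [← pairingBilin_apply, map_sub, map_sum, sub_eq_zero] at h0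
    simpa only [map_smul, smul_eq_mul, pairingBilin_apply] using h0
  rw [hleft]
  simp only [hright, hbasis]
  exact sum_mul_symplecticForm_single P P'

end Identity

end BilinearIdentity

end

/-- The sum is over the edges of the triangulation `T` of `S`. Each edge `e` is given an arbitrary
orientation and an arbitrary lift `c e` to the universal covering. -/
theorem mainTheorem7
    {S : Type*} [TopologicalSpace S] [ConnectedSpace S]
    (T : BilinearIdentity.Triangulation S)
    (g : ℕ) (hg : 1 ≤ g) (hT : T.HasGenus g)
    {E : Type*} [TopologicalSpace E] [SimplyConnectedSpace E]
    (p : E → S) (hp : IsCoveringMap p) (z₀ : E)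
    (α β : Fin g → Path (p z₀) (p z₀))
    (hαβ : BilinearIdentity.IsStandardBasis α β)
    (dα dβ : Fin g → BilinearIdentity.Deck p)
    (hdα : ∀ k, (dα k).IsOf (α k)) (hdβ : ∀ k, (dβ k).IsOf (β k))
    (hpos : ∃ k n, BilinearIdentity.IsIntersectionNumber T (dα k) (dβ k) n ∧ 0 < n)
    (u : T.LiftedVertex p → ℝ) (u' : T.LiftedFace p → ℝ)
    (A B A' B' : Fin g → ℝ)
    (hu : BilinearIdentity.IsMultivaluedOnVertices dα dβ u A B)
    (hu' : BilinearIdentity.IsMultivaluedOnFaces dα dβ u' A' B')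
    (c : T.Edge → T.LiftedEdge p)
    (hc : ∀ e, BilinearIdentity.Triangulation.OrientedEdge.edge (c e).proj = e) :
    ∑ e : T.Edge, (u' (c e).left - u' (c e).right) * (u (c e).head - u (c e).tail)
      = ∑ k, (A k * B' k - B k * A' k) := by
  have htrans : BilinearIdentity.FibreTransitive
      (Subgroup.closure (Set.range (Sum.elim dα dβ))) := by
    intro z z' h
    rw [Set.Sum.elim_range]
    exact BilinearIdentity.Deck.exists_mem_closure_apply_eq hp hαβ hdα hdβ h
  obtain ⟨k, n, hk, hn⟩ := hpos
  refine BilinearIdentity.pairing_eq_symplecticForm hp hc hT htrans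
    (BilinearIdentity.Deck.prod_commutator_eq_one hp hαβ hdα hdβ) hk hn
    (P := Sum.elim A B) (P' := Sum.elim A' B') ?_ ?_
  · rintro (j | j) z
    · exact eq_add_of_sub_eq' (hu j z).1
    · exact eq_add_of_sub_eq' (hu j z).2
  · rintro (j | j) W
    · exact eq_add_of_sub_eq' (hu' j W).1
    · exact eq_add_of_sub_eq' (hu' j W).2
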